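/- Let $N\ge 1$ and let $\varphi^{(1)},\dots,\varphi^{(N-1)}$ be real numbers. Write a configuration of $N$ points of the $1+1$-dimensional space-time (metric $\mathrm{diag}(1,-1)$) as $x=(t_1,z_1,\dots,t_N,z_N)\in\mathbb R^{2N}$ and let $$\mathscr S_1=\{x:\ (t_j-t_k)^2-(z_j-z_k)^2<0\ \ \forall j\ne k,\ \ z_1<\dots<z_N\},\qquad \mathscr C_{k,k+1}=\{x\in\overline{\mathscr S}_1:\ t_k=t_{k+1},\ z_k=z_{k+1}\}.$$ Wave functions $\psi:\overline{\mathscr S}_1\to(\mathbb C^2)^{\otimes N}$ have components $\psi_{s_1\dots s_N}$, $s_k=\pm1$ (ordered so that $-$ precedes $+$). The model consists of the massless multi-time Dirac equations $i\gamma_k^\mu\partial_{k,\mu}\psi=0$, $k=1,\dots,N$, on $\mathscr S_1$, with $\gamma^0=\sigma_1$, $\gamma^1=\sigma_1\sigma_3$ (that is, $(\partial_{t_k}-s_k\partial_{z_k})\psi_{s_1\dots s_N}=0$), and the boundary conditions $$\psi_{s_1\dots s_{k-1}+-s_{k+2}\dots s_N}=e^{i\varphi^{(k)}}\,\psi_{s_1\dots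 s_{k-1}-+s_{k+2}\dots s_N}\quad\text{on }\mathscr C_{k,k+1},\qquad k=1,\dots,N-1 .$$ Let $m\ge1$ be an integer. Initial data are functions $g_{s_1\dots s_N}$ of class $C^m$ on the closed set $\{z_1\le\dots\le z_N\}\subset\mathbb R^N$ (up to the boundary) such that for every $k$ and all $s$ with $(s_k,s_{k+1})=(+,-)$, writing $\tau_k$ for the transposition of $k$ and $k+1$: $g_s(z)=e^{i\varphi^{(k)}}g_{s\circ\tau_k}(z)$ where $z_k=z_{k+1}$, and this transition is $C^m$, i.e. the function equal to $g_s(z)$ if $z_1\le\dots\le z_N$ and to $e^{i\varphi^{(k)}}g_{s\circ\tau_k}(z\circ\tau_k)$ if $z\circ\tau_k$ is ordered in this way is $C^m$ on the union of these two closed sets. (a) For all such data there is a unique $\psi\in C^m(\overline{\mathscr S}_1,(\mathbb C^2)^{\otimes N})$ that satisfies the Dirac equations, the boundary conditions and $\psi_{s_1\dots s_N}(0,z_1,\dots,0,z_N)=g_{s_1\dots s_N}(z_1,\dots,z_N)$ for $z_1\le\dots\le z_N$. (b) At every point of $\overline{\mathscr S}_1$ at which the characteristic values $c_k=z_k+s_kt_k$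 are all different, $$\psi_{s_1\dots s_N}(t_1,z_1,\dots,t_N,z_N)=e^{i\phi^\pi_{s_1\dots s_N}}\,g_{s_{\pi(1)}\dots s_{\pi(N)}}(c_{\pi(1)},\dots,c_{\pi(N)}),$$ where $\pi$ is the unique permutation with $c_{\pi(1)}<\dots<c_{\pi(N)}$. Here the phases are given by $\phi^{\mathrm{id}}_{s}=0$ and $\phi^\pi_{s}=\phi^\sigma_{s\circ\tau_k}+s_k\varphi^{(k)}$ whenever $\pi=\tau_k\circ\sigma$ and $\sigma$ has fewer collisions (pairs $k<l$ with $\sigma(k)>\sigma(l)$) than $\pi$; for every pair $(\pi,s)$ that occurs in the formula these rules yield exactly one value. If some of the $c_k$ are equal, $\psi_{s_1\dots s_N}$ is given by continuous continuation of the formula. (c) Probability is conserved: with the current $j^{\mu_1\dots\mu_N}=\overline\psi\gamma_1^{\mu_1}\cdots\gamma_N^{\mu_N}\psi$ and the $N$-form $\omega_j=\sum_{\mu}(-1)^{\mu_1+\dots+\mu_N}j^{\mu_1\dots\mu_N}\,dx_1^{1-\mu_1}\wedge\dots\wedge dx_N^{1-\mu_N}$, one has $\int_{\Sigma^N\cap\mathscr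 S_1}\omega_j=\int_{(\Sigma')^N\cap\mathscr S_1}\omega_j$ for all smooth space-like Cauchy surfaces $\Sigma,\Sigma'$ (graphs $t=f(z)$ of smooth $f$ on $\mathbb R$ with $|f'|<1$ that meet every light-like line), one integral being convergent if and only if the other is. (d) The model is Lorentz invariant: every proper orthochronous Lorentz transformation $\Lambda$ (acting on all points simultaneously) maps $\mathscr S_1$ and each $\mathscr C_{k,k+1}$ onto itself, and if $\psi\in C^m(\overline{\mathscr S}_1)$ satisfies the Dirac equations and the boundary conditions, then so does $\psi'(x_1,\dots,x_N)=S(\Lambda)^{\otimes N}\psi(\Lambda^{-1}x_1,\dots,\Lambda^{-1}x_N)$, where $S(\Lambda)=\mathrm{diag}(\cosh\beta+\sinh\beta,\cosh\beta-\sinh\beta)$ for the boost of rapidity $2\beta$. -/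

import Mathlib

open scoped Topology ContDiff Matrix

noncomputable section

namespace MultiTimeDirac

/-! Space-time points are `Fin 2 → ℝ`, coordinate `0` being the time `t` and coordinate `1` the
position `z`; the metric is `diag (1, -1)`. -/

/-- Configurations `(x_1, …, x_N)` of `N` space-time points. -/
abbrev Config (N : ℕ) : Type := Fin N → Fin 2 → ℝ

/-- Spin indices `s_1 … s_N`; the value `0` stands for the sign `-`, the value `1` for `+`. -/
abbrev SpinIdx (N : ℕ) : Type := Fin N → Fin 2

/-- The spin space `(ℂ²)^{⊗ N}`, given by its `2 ^ N` components. -/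
abbrev SpinSpace (N : ℕ) : Type := SpinIdx N → ℂ

/-- The sign `± 1` denoted by a one-particle spin index. -/
def sgn : Fin 2 → ℝ := ![-1, 1]

/-! ### The domain -/

/-- The space-like configurations. -/
def spacelikeConfigs (N : ℕ) : Set (Config N) :=
  {x | ∀ j k, j ≠ k → (x j 0 - x k 0) ^ 2 - (x j 1 - x k 1) ^ 2 < 0}

/-- The component `z_1 < … < z_N` of the space-like configurations. -/
def S₁ (N : ℕ) : Set (Config N) :=
  {x | x ∈ spacelikeConfigs N ∧ StrictMono fun k => x k 1}

/-- The coincidence set of the neighbours `k` and `k + 1` in the closure of `S₁`. -/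
def coincidence {n : ℕ} (k : Fin n) : Set (Config (n + 1)) :=
  {x | x ∈ closure (S₁ (n + 1)) ∧ x k.castSucc = x k.succ}

/-- The transposition of the neighbours `k` and `k + 1`. -/
def adjSwap {n : ℕ} (k : Fin n) : Equiv.Perm (Fin (n + 1)) :=
  Equiv.swap k.castSucc k.succ

/-! ### The multi-time Dirac equations -/

/-- The gamma matrices `γ⁰ = σ₁`, `γ¹ = σ₁ σ₃`. -/
def gamma : Fin 2 → Matrix (Fin 2) (Fin 2) ℂ :=
  ![!![0, 1; 1, 0], !![0, -1; 1, 0]]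

/-- The operator `M_1 ⊗ … ⊗ M_N` on spin space. -/
def tensorMatrix {N : ℕ} (M : Fin N → Matrix (Fin 2) (Fin 2) ℂ) :
    Matrix (SpinIdx N) (SpinIdx N) ℂ :=
  Matrix.of fun s s' => ∏ k, M k (s k) (s' k)

/-- `γ_k^μ`: the matrix `γ^μ` acting on the spin index of particle `k`. -/
def gammaAt {N : ℕ} (k : Fin N) (μ : Fin 2) : Matrix (SpinIdx N) (SpinIdx N) ℂ :=
  tensorMatrix (Function.update (fun _ => 1) k (gamma μ))

/-- The partial derivative `∂ / ∂ x_k^μ`. -/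
def partialDeriv {N : ℕ} (k : Fin N) (μ : Fin 2) (ψ : Config N → SpinSpace N)
    (x : Config N) : SpinSpace N :=
  fderiv ℝ ψ x (Pi.single k (Pi.single μ 1))

/-- The system `i γ_k^μ ∂_{k,μ} ψ = 0`, `k = 1, …, N`, on `S₁`. -/
def SolvesDirac {N : ℕ} (ψ : Config N → SpinSpace N) : Prop :=
  ∀ x ∈ S₁ N, ∀ k, Complex.I • ∑ μ, gammaAt k μ *ᵥ partialDeriv k μ ψ x = 0

/-! ### Boundary and initial conditions -/

/-- `ψ_{… + - …} = exp (i φ_k) ψ_{… - + …}` on the coincidence set of `k` and `k + 1`. -/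
def BoundaryCondition {n : ℕ} (φ : Fin n → ℝ) (ψ : Config (n + 1) → SpinSpace (n + 1)) : Prop :=
  ∀ k, ∀ x ∈ coincidence k, ∀ s : SpinIdx (n + 1), s k.castSucc = 1 → s k.succ = 0 →
    ψ x s = Complex.exp (Complex.I * φ k) * ψ x (s ∘ adjSwap k)

/-- The ordered positions `z_1 ≤ … ≤ z_N`. -/
def ordered (N : ℕ) : Set (Fin N → ℝ) := {z | Monotone z}

/-- The configuration `(0, z_1, …, 0, z_N)`. -/
def atTimeZero {N : ℕ} (z : Fin N → ℝ) : Config N := fun k => ![0, z k]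

/-- The initial data, continued from `z_k ≤ z_{k+1}` to `z_k > z_{k+1}` by the rule of the
boundary condition. -/
def glue {n : ℕ} (φ : Fin n → ℝ) (g : (Fin (n + 1) → ℝ) → SpinSpace (n + 1)) (k : Fin n)
    (s : SpinIdx (n + 1)) (z : Fin (n + 1) → ℝ) : ℂ :=
  if z k.castSucc ≤ z k.succ then g z s
  else Complex.exp (Complex.I * φ k) * g (z ∘ adjSwap k) (s ∘ adjSwap k)

/-- Admissible initial data of class `C^m`: `C^m` up to the boundary of the ordered positions,
satisfying the boundary conditions, with a `C^m` transition across the boundary. -/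
structure AdmissibleData {n : ℕ} (m : ℕ) (φ : Fin n → ℝ)
    (g : (Fin (n + 1) → ℝ) → SpinSpace (n + 1)) : Prop where
  smooth : ContDiffOn ℝ m g (ordered (n + 1))
  boundary : ∀ k, ∀ z ∈ ordered (n + 1), z k.castSucc = z k.succ →
    ∀ s : SpinIdx (n + 1), s k.castSucc = 1 → s k.succ = 0 →
      g z s = Complex.exp (Complex.I * φ k) * g z (s ∘ adjSwap k)
  transition : ∀ k, ∀ s : SpinIdx (n + 1), s k.castSucc = 1 → s k.succ = 0 →
    ContDiffOn ℝ m (glue φ g k s) {z | z ∈ ordered (n + 1) ∨ z ∘ adjSwap k ∈ ordered (n + 1)}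

/-- The model without initial conditions: functions of class `C^m` on the closure of `S₁` that
solve the Dirac equations on `S₁` and satisfy the boundary conditions. Values outside the closure
of `S₁` are irrelevant. -/
structure SolvesModel {n : ℕ} (m : ℕ) (φ : Fin n → ℝ)
    (ψ : Config (n + 1) → SpinSpace (n + 1)) : Prop where
  smooth : ContDiffOn ℝ m ψ (closure (S₁ (n + 1)))
  dirac : SolvesDirac ψ
  boundary : BoundaryCondition φ ψ

/-- Solutions of class `C^m` of the initial boundary value problem with initial data `g`. -/
structure SolvesIBVP {n : ℕ} (m : ℕ) (φ : Fin n → ℝ)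
    (g : (Fin (n + 1) → ℝ) → SpinSpace (n + 1))
    (ψ : Config (n + 1) → SpinSpace (n + 1)) : Prop extends SolvesModel m φ ψ where
  initial : ∀ z ∈ ordered (n + 1), ψ (atTimeZero z) = g z

/-! ### The explicit formula -/

/-- The characteristic values `c_k = z_k + s_k t_k`. -/
def charValue {N : ℕ} (s : SpinIdx N) (x : Config N) : Fin N → ℝ :=
  fun k => x k 1 + sgn (s k) * x k 0

/-- The collisions of a permutation. -/
def collisions {N : ℕ} (π : Equiv.Perm (Fin N)) : Finset (Fin N × Fin N) :=
  Finset.univ.filter fun p => p.1 < p.2 ∧ π p.2 < π p.1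

/-- `IsPhase φ π s θ`: the rules `φ^id_s = 0` and
`φ^π_{s_1 … s_N} = φ^σ_{s_1 … s_{k+1} s_k … s_N} + s_k φ_k`, for `π = τ_k ∘ σ` with `σ` having fewer
collisions than `π`, give `θ` as a value of the phase `φ^π_s`. -/
inductive IsPhase {n : ℕ} (φ : Fin n → ℝ) :
    Equiv.Perm (Fin (n + 1)) → SpinIdx (n + 1) → ℝ → Prop
  | id (s : SpinIdx (n + 1)) : IsPhase φ 1 s 0
  | step (k : Fin n) (σ : Equiv.Perm (Fin (n + 1))) (s : SpinIdx (n + 1)) (θ : ℝ)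
      (fewer : (collisions σ).card < (collisions (adjSwap k * σ)).card)
      (prev : IsPhase φ σ (s ∘ adjSwap k) θ) :
      IsPhase φ (adjSwap k * σ) s (θ + sgn (s k.castSucc) * φ k)

/-- There is exactly one permutation `π` with `c_{π(1)} < … < c_{π(N)}`, the phase `φ^π_s` exists
and is unique, and `ψ_s = exp (i φ^π_s) g_{s_{π(1)} … s_{π(N)}} (c_{π(1)}, …, c_{π(N)})` at `x`. -/
def ExplicitFormulaAt {n : ℕ} (φ : Fin n → ℝ) (g : (Fin (n + 1) → ℝ) → SpinSpace (n + 1))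
    (ψ : Config (n + 1) → SpinSpace (n + 1)) (s : SpinIdx (n + 1)) (x : Config (n + 1)) : Prop :=
  ∃ (π : Equiv.Perm (Fin (n + 1))) (θ : ℝ),
    StrictMono (charValue s x ∘ π) ∧
    (∀ π' : Equiv.Perm (Fin (n + 1)), StrictMono (charValue s x ∘ π') → π' = π) ∧
    IsPhase φ π s θ ∧ (∀ θ', IsPhase φ π s θ' → θ' = θ) ∧
    ψ x s = Complex.exp (Complex.I * θ) * g (charValue s x ∘ π) (s ∘ π)

/-- The points of the closure of `S₁` at which the characteristic values of the component `s` are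
all different. -/
def distinctSet {N : ℕ} (s : SpinIdx N) : Set (Config N) :=
  {x | x ∈ closure (S₁ N) ∧ Function.Injective (charValue s x)}

/-! ### Probability conservation -/

/-- The tensor current `j^{μ_1 … μ_N} = ψ̄ γ_1^{μ_1} ⋯ γ_N^{μ_N} ψ`, where
`ψ̄ = ψ† γ_1^0 ⋯ γ_N^0`. -/
def current {N : ℕ} (Ψ : SpinSpace N) (μ : Fin N → Fin 2) : ℂ :=
  (star Ψ ᵥ* tensorMatrix fun _ => gamma 0) ⬝ᵥ ((tensorMatrix fun k => gamma (μ k)) *ᵥ Ψ)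

/-- The current `N`-form
`∑_μ (-1)^{μ_1 + … + μ_N} j^{μ_1 … μ_N} dx_1^{ν_1} ∧ … ∧ dx_N^{ν_N}`, at a point where the wave
function has the value `Ψ`, applied to tangent vectors `v_1, …, v_N` of the configuration space;
`ν_k` is the index that remains when `μ_k` is omitted. -/
def currentForm {N : ℕ} (Ψ : SpinSpace N) (v : Fin N → Config N) : ℂ :=
  ∑ μ : Fin N → Fin 2, (-1) ^ (∑ k, (μ k : ℕ)) * current Ψ μ *
    ((Matrix.of fun k l => v l k (μ k).rev).det : ℝ)

/-- The graph `{(f z, z)}` is a smooth space-like Cauchy surface: its tangents are space-like and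
it meets every light-like line. -/
structure IsSpacelikeCauchy (f : ℝ → ℝ) : Prop where
  smooth : ContDiff ℝ ∞ f
  spacelike : ∀ z, |deriv f z| < 1
  left : ∀ c, ∃ z, z + f z = c
  right : ∀ c, ∃ z, z - f z = c

/-- The parametrization of `Σ^N` by the positions, `Σ` being the graph of `f`. -/
def surfacePoint {N : ℕ} (f : ℝ → ℝ) (z : Fin N → ℝ) : Config N := fun k => ![f (z k), z k]

/-- The coordinate tangent vectors of this parametrization. -/
def surfaceTangent {N : ℕ} (f : ℝ → ℝ) (z : Fin N → ℝ) : Fin N → Config N :=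
  fun l => Pi.single l ![deriv f (z l), 1]

/-- The current form pulled back to `Σ^N`. -/
def surfaceDensity {N : ℕ} (ψ : Config N → SpinSpace N) (f : ℝ → ℝ) (z : Fin N → ℝ) : ℂ :=
  currentForm (ψ (surfacePoint f z)) (surfaceTangent f z)

/-- The set of parameters of `Σ^N ∩ S₁`. -/
def surfaceDomain (N : ℕ) (f : ℝ → ℝ) : Set (Fin N → ℝ) := {z | surfacePoint f z ∈ S₁ N}

/-- The integrals of the current form over `Σ^N ∩ S₁` and `Σ'^N ∩ S₁` agree, for all smooth
space-like Cauchy surfaces; if one of them converges, so does the other. -/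
def ConservesProbability {N : ℕ} (ψ : Config N → SpinSpace N) : Prop :=
  ∀ f f' : ℝ → ℝ, IsSpacelikeCauchy f → IsSpacelikeCauchy f' →
    (MeasureTheory.IntegrableOn (surfaceDensity ψ f) (surfaceDomain N f) ↔
      MeasureTheory.IntegrableOn (surfaceDensity ψ f') (surfaceDomain N f')) ∧
    ∫ z in surfaceDomain N f, surfaceDensity ψ f z =
      ∫ z in surfaceDomain N f', surfaceDensity ψ f' z

/-! ### Lorentz transformations -/

/-- The proper orthochronous Lorentz transformations of 1+1-dimensional space-time: the boosts, here
of rapidity `2 β`. The inverse is the boost with parameter `-β`. -/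
def boost (β : ℝ) : Matrix (Fin 2) (Fin 2) ℝ :=
  !![Real.cosh (2 * β), Real.sinh (2 * β); Real.sinh (2 * β), Real.cosh (2 * β)]

/-- The boost of all points of a configuration. -/
def boostConfig {N : ℕ} (β : ℝ) (x : Config N) : Config N := fun k => boost β *ᵥ x k

/-- The spinor transformation `S = exp (β σ₃)` that belongs to the boost of rapidity `2 β`. -/
def spinBoost (β : ℝ) : Matrix (Fin 2) (Fin 2) ℂ :=
  !![(Real.cosh β + Real.sinh β : ℝ), 0; 0, (Real.cosh β - Real.sinh β : ℝ)]

/-- The transformed wave function `(S ⊗ … ⊗ S) ψ (Λ⁻¹ x_1, …, Λ⁻¹ x_N)`. -/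
def lorentzTransform {N : ℕ} (β : ℝ) (ψ : Config N → SpinSpace N) : Config N → SpinSpace N :=
  fun x => (tensorMatrix fun _ => spinBoost β) *ᵥ ψ (boostConfig (-β) x)

/-- Lorentz invariance of the model: the domain and the coincidence sets are invariant, and the
transform of a solution of the Dirac equations and boundary conditions is again one. -/
def LorentzInvariant {n : ℕ} (m : ℕ) (φ : Fin n → ℝ) : Prop :=
  ∀ β : ℝ, boostConfig β '' S₁ (n + 1) = S₁ (n + 1) ∧
    (∀ k : Fin n, boostConfig β '' coincidence k = coincidence k) ∧
    ∀ ψ, SolvesModel m φ ψ → SolvesModel m φ (lorentzTransform β ψ)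

end MultiTimeDirac

end

noncomputable section

namespace MultiTimeDirac

/-! ### Null coordinates -/

/-! Everything rests on the null coordinates `z_k ± t_k`. Since `dt² - dz² = -(dz - dt)(dz + dt)`, a
configuration lies in `S₁` exactly when both families of null coordinates are strictly increasing
(`mem_S₁_iff`), and in its closure when both are weakly increasing. In components the Dirac
equations are transport equations, so on the convex set `S₁` the component `ψ_s` is a function of
the characteristic values `c_k = z_k + s_k t_k` alone. These values are ordered among particles of
equal sign (`signOrdered`) and otherwise free.

Existence: the phases have a potential (`gaugePhase`). A permutation that keeps the order of
particles of equal sign (`Compatible`) is undone by adjacent transpositions of opposite signs, and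
each of these changes the potential by `± φ_k`. So the phase depends only on the end points `s` and
`s ∘ π`. The explicit formula thus defines one function on each chamber of sorted values; the
boundary conditions on `g` make these agree on overlaps, and the `C^m` transitions make their
derivatives agree there (`contDiffOn_profile`).

Uniqueness: if neighbours have opposite signs, their characteristic values involve different null
coordinates, so any admissible values are attained on the coincidence set
(`exists_coincidence_of_ne`). The boundary condition there removes one collision, and induction
leads back to the initial data (`SolvesIBVP.eq_branch`).

Probability: the density on a surface is `∑_s |ψ_s|² ∏_k (1 + s_k f'(z_k))`, whose product is the
Jacobian of the map to characteristic values. The image of the ordered positions under this map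
depends on the surface, so components are not conserved singly; after symmetrization over all orders
each component is integrated over all of `ℝ^N`, where the surface drops out
(`IsSpacelikeCauchy.factorial_mul_lintegral`).

Lorentz invariance: a boost rescales each family of null coordinates by a positive factor. -/

/-- The null coordinate `z_k + b t_k` of the `k`-th point, where `b` is a sign. -/
def nullCoord {N : ℕ} (b : Fin 2) (x : Config N) : Fin N → ℝ :=
  fun k => x k 1 + sgn b * x k 0

theorem charValue_apply {N : ℕ} (s : SpinIdx N) (x : Config N) (k : Fin N) :
    charValue s x k = nullCoord (s k) x k := rfl

@[simp] theorem sgn_zero : sgn 0 = -1 := rfl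

@[simp] theorem sgn_one : sgn 1 = 1 := rfl

/-- The Minkowski square factors into the two null differences. Space-likeness says these have equal
sign, and the order of the positions makes that sign positive. -/
theorem mem_S₁_iff {N : ℕ} {x : Config N} : x ∈ S₁ N ↔ ∀ b, StrictMono (nullCoord b x) := by
  simp only [Fin.forall_fin_two]
  constructor
  · rintro ⟨hs, hz⟩
    have key : ∀ j k, j < k → |x j 0 - x k 0| < x k 1 - x j 1 := by
      intro j k hjk
      have h1 := hs j k hjk.ne
      have h2 : x j 1 < x k 1 := hz hjk
      apply abs_lt_of_sq_lt_sq <;> nlinarith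
    constructor <;> intro j k hjk <;> have h := abs_lt.1 (key j k hjk) <;>
      simp only [nullCoord, sgn_zero, sgn_one] <;> linarith [h.1, h.2]
  · rintro ⟨h0, h1⟩
    have key : ∀ j k, j < k → 0 < (x k 1 - x j 1) - (x k 0 - x j 0) ∧
        0 < (x k 1 - x j 1) + (x k 0 - x j 0) := by
      intro j k hjk
      have h0 := h0 hjk
      have h1 := h1 hjk
      simp only [nullCoord, sgn_zero, sgn_one] at h0 h1
      constructor <;> linarith
    refine ⟨fun j k hjk => ?_, fun j k hjk => ?_⟩
    · rcases lt_or_gt_of_ne hjk with h | h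
      · nlinarith [mul_pos (key j k h).1 (key j k h).2]
      · nlinarith [mul_pos (key k j h).1 (key k j h).2]
    · have := key j k hjk
      simp only
      linarith [this.1, this.2]

theorem continuous_nullCoord {N : ℕ} (b : Fin 2) (k : Fin N) :
    Continuous fun x : Config N => nullCoord b x k := by
  unfold nullCoord; fun_prop

/-- The reference configuration `(0, 0, 0, 1, …, 0, N - 1)`. -/
def spreadConfig (N : ℕ) : Config N := atTimeZero fun k => (k : ℝ)

theorem nullCoord_atTimeZero {N : ℕ} (b : Fin 2) (z : Fin N → ℝ) :
    nullCoord b (atTimeZero z) = z := by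
  ext k; simp [nullCoord, atTimeZero]

theorem charValue_atTimeZero {N : ℕ} (s : SpinIdx N) (z : Fin N → ℝ) :
    charValue s (atTimeZero z) = z := by
  ext k; simp [charValue, atTimeZero]

theorem nullCoord_add_smul {N : ℕ} (b : Fin 2) (x y : Config N) (ε : ℝ) (k : Fin N) :
    nullCoord b (x + ε • y) k = nullCoord b x k + ε * nullCoord b y k := by
  simp [nullCoord]; ring

/-- The shift adds `ε k` to both null coordinates of the `k`-th point and so turns weak inequalities
into strict ones. It serves to pass from the closure to `S₁`. -/
theorem add_smul_spread_mem_S₁ {N : ℕ} {x : Config N} (hx : ∀ b, Monotone (nullCoord b x))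
    {ε : ℝ} (hε : 0 < ε) : x + ε • spreadConfig N ∈ S₁ N := by
  rw [mem_S₁_iff]
  intro b j k hjk
  rw [nullCoord_add_smul, nullCoord_add_smul, spreadConfig, nullCoord_atTimeZero]
  have h1 := hx b hjk.le
  have h2 : (j : ℝ) < (k : ℝ) := by exact_mod_cast hjk
  nlinarith

theorem tendsto_add_smul {E : Type*} [NormedAddCommGroup E] [NormedSpace ℝ E] (x y : E) :
    Filter.Tendsto (fun ε : ℝ => x + ε • y) (𝓝[>] 0) (𝓝 x) := by
  have : Continuous fun ε : ℝ => x + ε • y := by fun_prop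
  have h := (this.tendsto 0).mono_left (nhdsWithin_le_nhds (s := Set.Ioi 0))
  simpa using h

theorem mem_closure_S₁_iff {N : ℕ} {x : Config N} :
    x ∈ closure (S₁ N) ↔ ∀ b, Monotone (nullCoord b x) := by
  constructor
  · intro hx b j k hjk
    have hc : IsClosed {x : Config N | nullCoord b x j ≤ nullCoord b x k} :=
      isClosed_le (continuous_nullCoord b j) (continuous_nullCoord b k)
    exact closure_minimal (fun y hy => (mem_S₁_iff.1 hy b).monotone hjk) hc hx
  · intro hx
    refine mem_closure_of_tendsto (tendsto_add_smul x (spreadConfig N)) ?_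
    filter_upwards [self_mem_nhdsWithin] with ε hε
    exact add_smul_spread_mem_S₁ hx hε

theorem isOpen_S₁ (N : ℕ) : IsOpen (S₁ N) := by
  have : S₁ N = ⋂ b : Fin 2, ⋂ j : Fin N, ⋂ k : Fin N, ⋂ _ : j < k,
      {x | nullCoord b x j < nullCoord b x k} := by
    ext x
    simp only [mem_S₁_iff, Set.mem_iInter, Set.mem_ofPred_eq]
    exact ⟨fun h b j k hjk => h b hjk, fun h b j k hjk => h b j k hjk⟩
  rw [this]
  refine isOpen_iInter_of_finite fun b => isOpen_iInter_of_finite fun j =>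
    isOpen_iInter_of_finite fun k => isOpen_iInter_of_finite fun _ => ?_
  exact isOpen_lt (continuous_nullCoord b j) (continuous_nullCoord b k)

/-- Characteristic values that are ordered among the particles of equal sign. -/
def signOrdered {N : ℕ} (s : SpinIdx N) : Set (Fin N → ℝ) :=
  {c | ∀ i j, i < j → s i = s j → c i ≤ c j}

theorem charValue_mem_signOrdered {N : ℕ} {x : Config N} (hx : x ∈ closure (S₁ N))
    (s : SpinIdx N) : charValue s x ∈ signOrdered s := by
  intro i j hij hs
  rw [charValue_apply, charValue_apply, hs]
  exact mem_closure_S₁_iff.1 hx _ hij.le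

/-! ### Permutations and adjacent transpositions -/

theorem adjSwap_lt_adjSwap {n : ℕ} {k : Fin n} {i j : Fin (n + 1)} (hij : i < j)
    (h : ¬(i = k.castSucc ∧ j = k.succ)) : adjSwap k i < adjSwap k j := by
  simp only [adjSwap, Equiv.swap_apply_def]
  simp only [Fin.ext_iff, Fin.val_castSucc, Fin.val_succ] at h ⊢
  rw [Fin.lt_def] at hij ⊢
  split_ifs <;> simp_all <;> omega

@[simp] theorem adjSwap_castSucc {n : ℕ} (k : Fin n) : adjSwap k k.castSucc = k.succ :=
  Equiv.swap_apply_left _ _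

@[simp] theorem adjSwap_succ {n : ℕ} (k : Fin n) : adjSwap k k.succ = k.castSucc :=
  Equiv.swap_apply_right _ _

@[simp] theorem adjSwap_adjSwap {n : ℕ} (k : Fin n) (i : Fin (n + 1)) :
    adjSwap k (adjSwap k i) = i := Equiv.swap_apply_self _ _ _

@[simp] theorem adjSwap_symm {n : ℕ} (k : Fin n) : (adjSwap k).symm = adjSwap k :=
  Equiv.symm_swap _ _

theorem adjSwap_mul_self {n : ℕ} (k : Fin n) : adjSwap k * adjSwap k = 1 :=
  Equiv.swap_mul_self _ _

theorem comp_adjSwap_adjSwap {n : ℕ} {α : Type*} (k : Fin n) (f : Fin (n + 1) → α) :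
    (f ∘ adjSwap k) ∘ adjSwap k = f := by
  ext i; simp

theorem comp_adjSwap_eq_self {n : ℕ} {α : Type*} {k : Fin n} {f : Fin (n + 1) → α}
    (h : f k.castSucc = f k.succ) : f ∘ adjSwap k = f := by
  ext i
  simp only [Function.comp, adjSwap, Equiv.swap_apply_def]
  split_ifs with h1 h2
  · rw [h1, h]
  · rw [h2, h]
  · rfl

theorem mem_collisions {N : ℕ} {π : Equiv.Perm (Fin N)} {p : Fin N × Fin N} :
    p ∈ collisions π ↔ p.1 < p.2 ∧ π p.2 < π p.1 := by
  unfold collisions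
  rw [Finset.mem_filter]
  simp

/-- An adjacent transposition of the values preserves every order relation except that of `k` and `k
+ 1`, so no collision is created and exactly the descent in question is lost. -/
theorem collisions_adjSwap_mul_lt {n : ℕ} {k : Fin n} {π : Equiv.Perm (Fin (n + 1))}
    (h : π.symm k.succ < π.symm k.castSucc) :
    (collisions (adjSwap k * π)).card < (collisions π).card := by
  apply Finset.card_lt_card
  rw [Finset.ssubset_iff_of_subset]
  · refine ⟨(π.symm k.succ, π.symm k.castSucc), ?_, ?_⟩
    · simpa [mem_collisions, Fin.castSucc_lt_succ] using h
    · simp [mem_collisions, Fin.castSucc_lt_succ.le]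
  · rintro ⟨p, q⟩ hpq
    simp only [mem_collisions, Equiv.Perm.mul_apply] at hpq ⊢
    refine ⟨hpq.1, ?_⟩
    by_contra hcon
    have hlt : π p < π q := lt_of_le_of_ne (not_lt.1 hcon) fun e => hpq.1.ne (π.injective e)
    refine absurd hpq.2 (not_lt.2 (adjSwap_lt_adjSwap hlt ?_).le)
    rintro ⟨hp, hq⟩
    rw [← hp, ← hq, Equiv.symm_apply_apply, Equiv.symm_apply_apply] at h
    exact absurd hpq.1 (not_lt.2 h.le)

theorem eq_of_strictMono_comp {N : ℕ} {c : Fin N → ℝ} {π π' : Equiv.Perm (Fin N)}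
    (h : StrictMono (c ∘ π)) (h' : StrictMono (c ∘ π')) : π = π' := by
  have hc : Function.Injective c := by
    have := h.injective.comp π.symm.injective
    rwa [Function.comp_assoc, Equiv.self_comp_symm, Function.comp_id] at this
  have : c ∘ π = c ∘ π' := by
    refine (StrictMono.range_inj h h').1 ?_
    rw [Set.range_comp, Set.range_comp, π.surjective.range_eq, π'.surjective.range_eq]
  ext1 i
  exact hc (congrFun this i)

theorem exists_descent {n : ℕ} {π : Equiv.Perm (Fin (n + 1))} (h : π ≠ 1) :
    ∃ k : Fin n, π.symm k.succ < π.symm k.castSucc := by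
  by_contra! hcon
  apply h
  have hm : StrictMono π.symm := Fin.strictMono_iff_lt_succ.2 fun k =>
    lt_of_le_of_ne (hcon k) fun e => Fin.castSucc_lt_succ.ne (π.symm.injective e)
  exact inv_eq_one.1 ((Equiv.Perm.monotone_iff π⁻¹).1 hm.monotone)

/-- Permutations that keep the order of the particles of equal sign. -/
def Compatible {N : ℕ} (s : SpinIdx N) (π : Equiv.Perm (Fin N)) : Prop :=
  ∀ i j, i < j → s i = s j → π.symm i < π.symm j

theorem compatible_one {N : ℕ} (s : SpinIdx N) : Compatible s 1 := fun _ _ h _ => h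

theorem Compatible.ne_of_descent {n : ℕ} {s : SpinIdx (n + 1)} {π : Equiv.Perm (Fin (n + 1))}
    (hs : Compatible s π) {k : Fin n} (h : π.symm k.succ < π.symm k.castSucc) :
    s k.castSucc ≠ s k.succ :=
  fun e => absurd (hs _ _ Fin.castSucc_lt_succ e) (not_lt.2 h.le)

theorem Compatible.adjSwap_mul {n : ℕ} {s : SpinIdx (n + 1)} {π : Equiv.Perm (Fin (n + 1))}
    (hs : Compatible s π) {k : Fin n} (h : s k.castSucc ≠ s k.succ) :
    Compatible (s ∘ adjSwap k) (adjSwap k * π) := by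
  intro i j hij e
  have : (adjSwap k * π).symm = (adjSwap k).trans π.symm := by
    ext i; simp [Equiv.Perm.mul_def]
  rw [this]
  simp only [Equiv.trans_apply]
  refine hs _ _ (adjSwap_lt_adjSwap hij ?_) e
  rintro ⟨rfl, rfl⟩
  simp only [Function.comp, adjSwap_castSucc, adjSwap_succ] at e
  exact h e.symm

/-- `Tuple.sort` is stable: ties are resolved by index. Particles of equal sign therefore keep their
order even when their characteristic values coincide. -/
theorem compatible_sort {N : ℕ} {s : SpinIdx N} {c : Fin N → ℝ} (hc : c ∈ signOrdered s) :
    Compatible s (Tuple.sort c) := by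
  intro i j hij e
  by_contra hcon
  have hlt : (Tuple.sort c).symm j < (Tuple.sort c).symm i :=
    lt_of_le_of_ne (not_lt.1 hcon) fun h => hij.ne ((Tuple.sort c).symm.injective h).symm
  have := Tuple.monotone_sort c hlt.le
  simp only [Function.comp, Equiv.apply_symm_apply] at this
  have h2 := (Tuple.eq_sort_iff.1 (rfl : Tuple.sort c = _)).2 _ _ hlt
  simp only [Equiv.apply_symm_apply] at h2
  exact absurd (h2 (le_antisymm this (hc i j hij e))) (not_lt.2 hij.le)

theorem mem_signOrdered_of_compatible {N : ℕ} {s : SpinIdx N} {c : Fin N → ℝ}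
    {π : Equiv.Perm (Fin N)} (hs : Compatible s π) (h : Monotone (c ∘ π)) : c ∈ signOrdered s := by
  intro i j hij e
  simpa using h (hs i j hij e).le

/-- Induction over the compatible permutations by removing collisions. -/
theorem Compatible.induction {n : ℕ} {P : SpinIdx (n + 1) → Equiv.Perm (Fin (n + 1)) → Prop}
    (one : ∀ s, P s 1)
    (step : ∀ (k : Fin n) (π : Equiv.Perm (Fin (n + 1))) (s : SpinIdx (n + 1)), Compatible s π →
      s k.castSucc ≠ s k.succ → π.symm k.succ < π.symm k.castSucc →
      P (s ∘ adjSwap k) (adjSwap k * π) → P s π)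
    {s : SpinIdx (n + 1)} {π : Equiv.Perm (Fin (n + 1))} (h : Compatible s π) : P s π := by
  induction hN : (collisions π).card using Nat.strong_induction_on generalizing s π with
  | _ N ih =>
    by_cases hπ : π = 1
    · rw [hπ]; exact one s
    · obtain ⟨k, hk⟩ := exists_descent hπ
      have hne := h.ne_of_descent hk
      refine step k π s h hne hk (ih _ ?_ (h.adjSwap_mul hne) rfl)
      rw [← hN]; exact collisions_adjSwap_mul_lt hk

/-- Two compatible permutations that sort `c` are connected by transpositions of neighbours with
equal values and opposite signs. -/
theorem sorting_induction {n : ℕ} {s : SpinIdx (n + 1)} {c : Fin (n + 1) → ℝ}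
    {P : Equiv.Perm (Fin (n + 1)) → Prop} {π' : Equiv.Perm (Fin (n + 1))}
    (hs' : Compatible s π') (hc' : Monotone (c ∘ π')) (base : P π')
    (step : ∀ (k : Fin n) (π : Equiv.Perm (Fin (n + 1))), Compatible s π → Monotone (c ∘ π) →
      Compatible s (π * adjSwap k) → Monotone (c ∘ (π * adjSwap k)) →
      (c ∘ π) k.castSucc = (c ∘ π) k.succ → (s ∘ π) k.castSucc ≠ (s ∘ π) k.succ →
      P (π * adjSwap k) → P π)
    {π : Equiv.Perm (Fin (n + 1))} (hs : Compatible s π) (hc : Monotone (c ∘ π)) : P π := by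
  induction hN : (collisions (π⁻¹ * π')).card using Nat.strong_induction_on generalizing π with
  | _ N ih =>
    by_cases hπ : π⁻¹ * π' = 1
    · rwa [inv_mul_eq_one.1 hπ]
    · obtain ⟨k, hk⟩ := exists_descent hπ
      have hk' : π'.symm (π k.succ) < π'.symm (π k.castSucc) := hk
      -- `π'` inverts the pair that `π` puts in places `k`, `k + 1`, yet both sort `c`; the two
      -- values must be equal.
      have hval : (c ∘ π) k.castSucc = (c ∘ π) k.succ := by
        refine le_antisymm (hc Fin.castSucc_lt_succ.le) ?_
        simpa using hc' hk'.le
      have hne : (s ∘ π) k.castSucc ≠ (s ∘ π) k.succ := by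
        intro e
        rcases lt_trichotomy (π k.castSucc) (π k.succ) with h | h | h
        · exact absurd (hs' _ _ h e) (not_lt.2 hk'.le)
        · exact Fin.castSucc_lt_succ.ne (π.injective h)
        · have := hs _ _ h e.symm
          simp only [Equiv.symm_apply_apply] at this
          exact absurd this (not_lt.2 Fin.castSucc_lt_succ.le)
      have hs1 : Compatible s (π * adjSwap k) := by
        intro i j hij e
        have : (π * adjSwap k).symm = π.symm.trans (adjSwap k) := by
          ext i; simp [Equiv.Perm.mul_def]
        rw [this]
        simp only [Equiv.trans_apply]
        refine adjSwap_lt_adjSwap (hs i j hij e) ?_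
        rintro ⟨h1, h2⟩
        rw [Equiv.symm_apply_eq] at h1 h2
        subst h1 h2
        exact hne e
      have hc1 : Monotone (c ∘ (π * adjSwap k)) := by
        have : c ∘ (π * adjSwap k) = c ∘ π := comp_adjSwap_eq_self (f := c ∘ π) hval
        rwa [this]
      refine step k π hs hc hs1 hc1 hval hne (ih _ ?_ hs1 hc1 rfl)
      rw [← hN]
      have : (π * adjSwap k)⁻¹ * π' = adjSwap k * (π⁻¹ * π') := by
        rw [mul_inv_rev, mul_assoc]; congr 1
      rw [this]
      exact collisions_adjSwap_mul_lt hk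

/-! ### Phases -/

/-- The potential of the phases. -/
def gaugePhase {n : ℕ} (φ : Fin n → ℝ) (s : SpinIdx (n + 1)) : ℝ :=
  ∑ j, ((s j : ℕ) : ℝ) * ∑ i : Fin n, if i.castSucc < j then φ i else 0

/-- Each `+` at place `j` carries the weight `∑_{i<j} φ_i`. Exchanging opposite signs moves one `+`
across the bond `k`, and the weights of its two ends differ by `φ_k`. -/
theorem gaugePhase_adjSwap {n : ℕ} (φ : Fin n → ℝ) {s : SpinIdx (n + 1)} {k : Fin n}
    (h : s k.castSucc ≠ s k.succ) :
    gaugePhase φ (s ∘ adjSwap k) = gaugePhase φ s + sgn (s k.castSucc) * φ k := by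
  set W : Fin (n + 1) → ℝ := fun j => ∑ i : Fin n, if i.castSucc < j then φ i else 0 with hW
  have hWk : W k.succ = W k.castSucc + φ k := by
    have : φ k = ∑ i : Fin n, if i = k then φ i else 0 := by simp
    rw [hW]
    simp only
    rw [this, ← Finset.sum_add_distrib]
    refine Finset.sum_congr rfl fun i _ => ?_
    rcases lt_trichotomy i k with h1 | h1 | h1
    · simp [h1, h1.ne, h1.le]
    · simp [h1]
    · simp [h1.not_ge, h1.ne', h1.not_gt]
  have e1 : gaugePhase φ (s ∘ adjSwap k) = ∑ j, ((s j : ℕ) : ℝ) * W (adjSwap k j) := by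
    rw [gaugePhase, ← Equiv.sum_comp (adjSwap k)]
    simp [hW]
  have e2 : gaugePhase φ s = ∑ j, ((s j : ℕ) : ℝ) * W j := rfl
  have e3 : ∑ j, (((s j : ℕ) : ℝ) * W (adjSwap k j) - ((s j : ℕ) : ℝ) * W j) =
      (((s k.castSucc : ℕ) : ℝ) * W (adjSwap k k.castSucc)
        - ((s k.castSucc : ℕ) : ℝ) * W k.castSucc) +
      (((s k.succ : ℕ) : ℝ) * W (adjSwap k k.succ) - ((s k.succ : ℕ) : ℝ) * W k.succ) := by
    refine Fintype.sum_eq_add _ _ Fin.castSucc_lt_succ.ne fun j hj => ?_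
    rw [adjSwap, Equiv.swap_apply_of_ne_of_ne hj.1 hj.2, sub_self]
  rw [Finset.sum_sub_distrib, ← e1, ← e2, adjSwap_castSucc, adjSwap_succ, hWk] at e3
  rw [← sub_eq_iff_eq_add', e3]
  generalize s k.castSucc = a at *
  generalize s k.succ = b at *
  fin_cases a <;> fin_cases b <;> simp_all

theorem comp_adjSwap_comp_mul {n : ℕ} {α : Type*} (k : Fin n) (f : Fin (n + 1) → α)
    (π : Equiv.Perm (Fin (n + 1))) : (f ∘ adjSwap k) ∘ (adjSwap k * π) = f ∘ π := by
  ext i; simp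

/-- Along a reduction of `π` by adjacent transpositions the potential differences telescope. -/
theorem Compatible.isPhase {n : ℕ} (φ : Fin n → ℝ) {s : SpinIdx (n + 1)}
    {π : Equiv.Perm (Fin (n + 1))} (h : Compatible s π) :
    IsPhase φ π s (gaugePhase φ (s ∘ π) - gaugePhase φ s) := by
  refine Compatible.induction
    (P := fun s π => IsPhase φ π s (gaugePhase φ (s ∘ π) - gaugePhase φ s)) ?_ ?_ h
  · intro s
    have := IsPhase.id (φ := φ) s
    simpa using this
  · intro k π s hs hne hk ih
    have hmul : adjSwap k * (adjSwap k * π) = π := by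
      rw [← mul_assoc, adjSwap_mul_self, one_mul]
    have := IsPhase.step k (adjSwap k * π) s _ (by
      rw [hmul]; exact collisions_adjSwap_mul_lt hk) ih
    rw [hmul, comp_adjSwap_comp_mul, gaugePhase_adjSwap φ hne] at this
    convert this using 1
    ring

/-- Compatibility is what makes the phase unique: it forces opposite signs in each exchange. For
equal signs the rules are inconsistent in general, as for three `+` and the order-reversing
permutation. -/
theorem IsPhase.eq_of_compatible {n : ℕ} {φ : Fin n → ℝ} {s : SpinIdx (n + 1)}
    {π : Equiv.Perm (Fin (n + 1))} {θ : ℝ} (hθ : IsPhase φ π s θ) (h : Compatible s π) :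
    θ = gaugePhase φ (s ∘ π) - gaugePhase φ s := by
  induction hθ with
  | id s => simp
  | step k σ s θ fewer prev ih =>
    have hmul : adjSwap k * (adjSwap k * σ) = σ := by
      rw [← mul_assoc, adjSwap_mul_self, one_mul]
    have hlt : (adjSwap k * σ).symm k.succ < (adjSwap k * σ).symm k.castSucc := by
      -- Without a descent of `τ_k σ` at `k`, `σ` itself would have one there, so `τ_k σ` would have
      -- fewer collisions than `σ`.
      by_contra hcon
      have e1 : (adjSwap k * σ).symm k.succ = σ.symm k.castSucc := by
        simp [Equiv.Perm.mul_def]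
      have e2 : (adjSwap k * σ).symm k.castSucc = σ.symm k.succ := by
        simp [Equiv.Perm.mul_def]
      rw [e1, e2] at hcon
      have : σ.symm k.succ < σ.symm k.castSucc :=
        lt_of_le_of_ne (not_lt.1 hcon) fun e => Fin.castSucc_lt_succ.ne (σ.symm.injective e).symm
      exact absurd (collisions_adjSwap_mul_lt this) (not_lt.2 fewer.le)
    have hne := h.ne_of_descent hlt
    have h' := h.adjSwap_mul hne
    rw [hmul] at h'
    rw [ih h', gaugePhase_adjSwap φ hne, Function.comp_assoc, ← Equiv.Perm.coe_mul]
    ring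

section

/-! ### Gluing functions of class `C^m` along closed sets -/

section Gluing

variable {E F ι : Type*} [NormedAddCommGroup E] [NormedSpace ℝ E] [NormedAddCommGroup F]
  [NormedSpace ℝ F]

theorem hasFDerivWithinAt_iUnion [Finite ι] {s : ι → Set E} {f : E → F} {f' : E →L[ℝ] F} {x : E}
    (h : ∀ i, HasFDerivWithinAt f f' (s i) x) : HasFDerivWithinAt f f' (⋃ i, s i) x := by
  rw [hasFDerivWithinAt_iff_tendsto, nhdsWithin_iUnion, Filter.tendsto_iSup]
  exact fun i => hasFDerivWithinAt_iff_tendsto.1 (h i)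

theorem hasFTaylorSeriesUpToOn_iUnion [Finite ι] {K : ι → Set E} (hK : ∀ i, IsClosed (K i))
    {m : ℕ∞ω} {f : E → F} {p : E → FormalMultilinearSeries ℝ E F}
    (h : ∀ i, HasFTaylorSeriesUpToOn m f p (K i)) :
    HasFTaylorSeriesUpToOn m f p (⋃ i, K i) where
  zero_eq x hx := by
    obtain ⟨i, hi⟩ := Set.mem_iUnion.1 hx
    exact (h i).zero_eq x hi
  fderivWithin k hk x _ := by
    refine hasFDerivWithinAt_iUnion fun i => ?_
    by_cases hi : x ∈ K i
    · exact (h i).fderivWithin k hk x hi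
    -- Away from the closed piece the condition on the derivative is vacuous.
    · exact .of_notMem_closure (by rwa [(hK i).closure_eq])
  cont k hk := (locallyFinite_of_finite K).continuousOn_iUnion hK fun i => (h i).cont k hk

/-- Since the derivatives of the pieces agree on overlaps, choosing any piece at each point gives
one Taylor series valid on all of them. -/
theorem contDiffOn_iUnion [Finite ι] {K : ι → Set E} (hK : ∀ i, IsClosed (K i))
    (hu : ∀ i, UniqueDiffOn ℝ (K i)) {m : ℕ} {f : E → F} (hf : ∀ i, ContDiffOn ℝ m f (K i))
    (h : ∀ x i j, x ∈ K i → x ∈ K j → ∀ k : ℕ, k ≤ m →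
      iteratedFDerivWithin ℝ k f (K i) x = iteratedFDerivWithin ℝ k f (K j) x) :
    ContDiffOn ℝ m f (⋃ i, K i) := by
  classical
  let p : E → FormalMultilinearSeries ℝ E F := fun x =>
    if hx : ∃ i, x ∈ K i then ftaylorSeriesWithin ℝ f (K hx.choose) x else 0
  have hp : ∀ i, HasFTaylorSeriesUpToOn (m : ℕ∞) f p (K i) := by
    intro i
    refine ((hf i).ftaylorSeriesWithin (hu i)).congr_series fun k hk x hx => ?_
    have hex : ∃ i, x ∈ K i := ⟨i, hx⟩
    simp only [p, dif_pos hex]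
    exact h x _ _ hx hex.choose_spec k (by exact_mod_cast hk)
  exact (hasFTaylorSeriesUpToOn_iUnion hK hp).contDiffOn

/-- Both sides equal the iterated derivative within the union. -/
theorem iteratedFDerivWithin_eq_of_contDiffOn_union {s t : Set E} (hs : UniqueDiffOn ℝ s)
    (ht : UniqueDiffOn ℝ t) {m k : ℕ} {f : E → F} (hf : ContDiffOn ℝ m f (s ∪ t)) (hk : k ≤ m)
    {x : E} (hxs : x ∈ s) (hxt : x ∈ t) :
    iteratedFDerivWithin ℝ k f s x = iteratedFDerivWithin ℝ k f t x := by
  have hu : UniqueDiffOn ℝ (s ∪ t) := by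
    rintro y (hy | hy)
    · exact (hs y hy).mono Set.subset_union_left
    · exact (ht y hy).mono Set.subset_union_right
  have hf' : ContDiffOn ℝ k f (s ∪ t) := hf.of_le (by exact_mod_cast hk)
  rw [iteratedFDerivWithin_subset Set.subset_union_left hs hu hf' hxs,
    iteratedFDerivWithin_subset Set.subset_union_right ht hu hf' hxt]

end Gluing

/-! ### Chambers -/

/-- The values that are sorted by the permutation `π`. -/
def chamber {N : ℕ} (π : Equiv.Perm (Fin N)) : Set (Fin N → ℝ) := {c | Monotone (c ∘ π)}

theorem mem_chamber {N : ℕ} {π : Equiv.Perm (Fin N)} {c : Fin N → ℝ} :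
    c ∈ chamber π ↔ Monotone (c ∘ π) := Iff.rfl

theorem isClosed_chamber {N : ℕ} (π : Equiv.Perm (Fin N)) : IsClosed (chamber π) := by
  have : chamber π = ⋂ i : Fin N, ⋂ j : Fin N, ⋂ _ : i ≤ j, {c | c (π i) ≤ c (π j)} := by
    ext c
    simp only [Set.mem_iInter]
    exact ⟨fun h i j hij => h hij, fun h i j hij => h i j hij⟩
  rw [this]
  refine isClosed_iInter fun i => isClosed_iInter fun j => isClosed_iInter fun _ => ?_
  exact isClosed_le (continuous_apply _) (continuous_apply _)

theorem convex_chamber {N : ℕ} (π : Equiv.Perm (Fin N)) : Convex ℝ (chamber π) := by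
  intro c hc d hd a b ha hb _ i j hij
  have h1 := hc hij
  have h2 := hd hij
  simp only [Function.comp, Pi.add_apply, Pi.smul_apply, smul_eq_mul] at h1 h2 ⊢
  gcongr

theorem isOpen_strictMono_comp {N : ℕ} (π : Equiv.Perm (Fin N)) :
    IsOpen {c : Fin N → ℝ | StrictMono (c ∘ π)} := by
  have : {c : Fin N → ℝ | StrictMono (c ∘ π)} =
      ⋂ i : Fin N, ⋂ j : Fin N, ⋂ _ : i < j, {c | c (π i) < c (π j)} := by
    ext c
    simp only [Set.mem_iInter]
    exact ⟨fun h i j hij => h hij, fun h i j hij => h i j hij⟩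
  rw [this]
  refine isOpen_iInter_of_finite fun i => isOpen_iInter_of_finite fun j =>
    isOpen_iInter_of_finite fun _ => ?_
  exact isOpen_lt (continuous_apply _) (continuous_apply _)

theorem uniqueDiffOn_chamber {N : ℕ} (π : Equiv.Perm (Fin N)) : UniqueDiffOn ℝ (chamber π) := by
  -- The point with `c (π i) = i` is strictly sorted by `π`, hence interior.
  refine uniqueDiffOn_convex (convex_chamber π) ⟨fun k => ((π.symm k : ℕ) : ℝ), ?_⟩
  refine mem_interior.2 ⟨_, fun c hc => StrictMono.monotone hc, isOpen_strictMono_comp π, ?_⟩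
  intro i j hij
  simpa using hij

theorem contDiff_comp_perm {N : ℕ} (π : Equiv.Perm (Fin N)) {m : ℕ∞ω} :
    ContDiff ℝ m fun c : Fin N → ℝ => c ∘ π :=
  contDiff_pi.2 fun i => contDiff_apply ℝ ℝ (π i)

/-! ### The phase factor -/

/-- The phase factor between the components `s` and `w`. -/
def phaseFactor {n : ℕ} (φ : Fin n → ℝ) (s w : SpinIdx (n + 1)) : ℂ :=
  Complex.exp (Complex.I * ((gaugePhase φ w - gaugePhase φ s : ℝ) : ℂ))

@[simp] theorem phaseFactor_self {n : ℕ} (φ : Fin n → ℝ) (s : SpinIdx (n + 1)) :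
    phaseFactor φ s s = 1 := by simp [phaseFactor]

theorem phaseFactor_mul {n : ℕ} (φ : Fin n → ℝ) (s w v : SpinIdx (n + 1)) :
    phaseFactor φ s w * phaseFactor φ w v = phaseFactor φ s v := by
  rw [phaseFactor, phaseFactor, phaseFactor, ← Complex.exp_add]
  congr 1
  push_cast
  ring

theorem phaseFactor_adjSwap {n : ℕ} (φ : Fin n → ℝ) {s : SpinIdx (n + 1)} {k : Fin n}
    (h1 : s k.castSucc = 1) (h0 : s k.succ = 0) :
    phaseFactor φ s (s ∘ adjSwap k) = Complex.exp (Complex.I * φ k) := by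
  rw [phaseFactor, gaugePhase_adjSwap φ (by simp [h1, h0]), h1]
  simp

/-- A boundary condition at the neighbours `k` and `k + 1` in gauge invariant form. -/
theorem eq_phaseFactor_mul_of_ne {n : ℕ} {φ : Fin n → ℝ} {k : Fin n} {G : SpinIdx (n + 1) → ℂ}
    (hG : ∀ s : SpinIdx (n + 1), s k.castSucc = 1 → s k.succ = 0 →
      G s = Complex.exp (Complex.I * φ k) * G (s ∘ adjSwap k))
    {s : SpinIdx (n + 1)} (hs : s k.castSucc ≠ s k.succ) :
    G s = phaseFactor φ s (s ∘ adjSwap k) * G (s ∘ adjSwap k) := by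
  have hcases : (s k.castSucc = 1 ∧ s k.succ = 0) ∨ (s k.castSucc = 0 ∧ s k.succ = 1) := by
    revert hs
    generalize s k.castSucc = a
    generalize s k.succ = b
    fin_cases a <;> fin_cases b <;> simp
  rcases hcases with ⟨h1, h0⟩ | ⟨h0, h1⟩
  · rw [phaseFactor_adjSwap φ h1 h0]; exact hG s h1 h0
  · have h1' : (s ∘ adjSwap k) k.castSucc = 1 := by simpa using h1
    have h0' : (s ∘ adjSwap k) k.succ = 0 := by simpa using h0
    have := hG (s ∘ adjSwap k) h1' h0'
    rw [← phaseFactor_adjSwap φ h1' h0', comp_adjSwap_adjSwap] at this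
    rw [this, ← mul_assoc, phaseFactor_mul, phaseFactor_self, one_mul]

/-! ### The solution in characteristic values -/

/-- The explicit formula for the permutation `π`, as a function of the characteristic values. -/
def branch {n : ℕ} (φ : Fin n → ℝ) (g : (Fin (n + 1) → ℝ) → SpinSpace (n + 1))
    (s : SpinIdx (n + 1)) (π : Equiv.Perm (Fin (n + 1))) (c : Fin (n + 1) → ℝ) : ℂ :=
  phaseFactor φ s (s ∘ π) * g (c ∘ π) (s ∘ π)

/-- The component `s` of the solution as a function of the characteristic values. -/
def profile {n : ℕ} (φ : Fin n → ℝ) (g : (Fin (n + 1) → ℝ) → SpinSpace (n + 1))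
    (s : SpinIdx (n + 1)) (c : Fin (n + 1) → ℝ) : ℂ :=
  branch φ g s (Tuple.sort c) c

variable {n m : ℕ} {φ : Fin n → ℝ} {g : (Fin (n + 1) → ℝ) → SpinSpace (n + 1)}

/-- Permutations sorting the same `c` differ by exchanges of equal neighbouring values with opposite
signs. The boundary condition on `g` compensates the phase of each exchange. -/
theorem branch_eq_branch (hg : AdmissibleData m φ g) {s : SpinIdx (n + 1)}
    {c : Fin (n + 1) → ℝ} {π π' : Equiv.Perm (Fin (n + 1))} (hs : Compatible s π)
    (hc : c ∈ chamber π) (hs' : Compatible s π') (hc' : c ∈ chamber π') :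
    branch φ g s π c = branch φ g s π' c := by
  refine sorting_induction (P := fun π => branch φ g s π c = branch φ g s π' c) hs' hc' rfl ?_ hs hc
  intro k π _ hπ _ _ hval hne ih
  rw [← ih, branch, branch]
  have e1 : c ∘ (π * adjSwap k) = c ∘ π := comp_adjSwap_eq_self (f := c ∘ π) hval
  have e2 : s ∘ (π * adjSwap k) = (s ∘ π) ∘ adjSwap k := rfl
  rw [e1, e2, eq_phaseFactor_mul_of_ne (G := g (c ∘ π)) (hg.boundary k _ hπ hval) hne,
    ← mul_assoc, phaseFactor_mul]

theorem profile_eq_branch (hg : AdmissibleData m φ g) {s : SpinIdx (n + 1)}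
    {c : Fin (n + 1) → ℝ} {π : Equiv.Perm (Fin (n + 1))} (hs : Compatible s π)
    (hc : c ∈ chamber π) : profile φ g s c = branch φ g s π c :=
  branch_eq_branch hg (compatible_sort (mem_signOrdered_of_compatible hs hc))
    (Tuple.monotone_sort c) hs hc

theorem contDiffOn_profile_chamber (hg : AdmissibleData m φ g) {s : SpinIdx (n + 1)}
    {π : Equiv.Perm (Fin (n + 1))} (hs : Compatible s π) :
    ContDiffOn ℝ m (profile φ g s) (chamber π) := by
  have h : ContDiffOn ℝ m (branch φ g s π) (chamber π) :=
    contDiffOn_const.mul ((contDiffOn_pi.1 hg.smooth (s ∘ π)).comp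
      (contDiff_comp_perm π).contDiffOn fun c hc => hc)
  exact h.congr fun c hc => profile_eq_branch hg hs hc

/-- On two adjacent chambers the profile is a constant phase times the glued initial datum, which is
`C^m` by the transition hypothesis. -/
theorem contDiffOn_profile_union_of_pos (hg : AdmissibleData m φ g) {s : SpinIdx (n + 1)}
    {π : Equiv.Perm (Fin (n + 1))} {k : Fin n} (hs : Compatible s π)
    (hs' : Compatible s (π * adjSwap k)) (h1 : (s ∘ π) k.castSucc = 1) (h0 : (s ∘ π) k.succ = 0) :
    ContDiffOn ℝ m (profile φ g s) (chamber π ∪ chamber (π * adjSwap k)) := by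
  have h : ContDiffOn ℝ m (fun c => phaseFactor φ s (s ∘ π) * glue φ g k (s ∘ π) (c ∘ π))
      (chamber π ∪ chamber (π * adjSwap k)) :=
    contDiffOn_const.mul ((hg.transition k (s ∘ π) h1 h0).comp
      (contDiff_comp_perm π).contDiffOn fun c hc => hc)
  refine h.congr fun c hc => ?_
  have key : ∀ hc : c ∈ chamber π,
      profile φ g s c = phaseFactor φ s (s ∘ π) * glue φ g k (s ∘ π) (c ∘ π) := by
    intro hc
    rw [profile_eq_branch hg hs hc, branch, glue, if_pos (hc Fin.castSucc_lt_succ.le)]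
  rcases hc with hc | hc
  · exact key hc
  · by_cases hle : (c ∘ π) k.castSucc ≤ (c ∘ π) k.succ
    -- On the common wall of the two chambers the values at `k` and `k + 1` agree, and the point
    -- belongs to the first chamber as well.
    · apply key
      have hge : (c ∘ π) k.succ ≤ (c ∘ π) k.castSucc := by
        simpa using hc (Fin.castSucc_lt_succ (i := k)).le
      have := comp_adjSwap_eq_self (f := c ∘ π) (le_antisymm hle hge)
      rw [mem_chamber, ← this]
      exact hc
    · rw [profile_eq_branch hg hs' hc, branch, glue, if_neg hle, ← phaseFactor_adjSwap φ h1 h0,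
        ← mul_assoc, phaseFactor_mul]
      rfl

theorem contDiffOn_profile_union (hg : AdmissibleData m φ g) {s : SpinIdx (n + 1)}
    {π : Equiv.Perm (Fin (n + 1))} {k : Fin n} (hs : Compatible s π)
    (hs' : Compatible s (π * adjSwap k)) (hne : (s ∘ π) k.castSucc ≠ (s ∘ π) k.succ) :
    ContDiffOn ℝ m (profile φ g s) (chamber π ∪ chamber (π * adjSwap k)) := by
  have hcases : ((s ∘ π) k.castSucc = 1 ∧ (s ∘ π) k.succ = 0) ∨
      ((s ∘ π) k.castSucc = 0 ∧ (s ∘ π) k.succ = 1) := by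
    revert hne
    generalize (s ∘ π) k.castSucc = a
    generalize (s ∘ π) k.succ = b
    fin_cases a <;> fin_cases b <;> simp
  rcases hcases with ⟨h1, h0⟩ | ⟨h0, h1⟩
  · exact contDiffOn_profile_union_of_pos hg hs hs' h1 h0
  -- The transition hypothesis covers only the signs `(+, -)`; here the two chambers exchange roles.
  · have hmul : π * adjSwap k * adjSwap k = π := by
      rw [mul_assoc, adjSwap_mul_self, mul_one]
    have := contDiffOn_profile_union_of_pos (k := k) hg hs' (by rwa [hmul])
      (by simpa using h1) (by simpa using h0)
    rwa [hmul, Set.union_comm] at this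

/-- Several chambers may meet at `c`, but any two are linked by exchanges of equal neighbouring
values. The pairwise smoothness across each wall carries the iterated derivatives along this chain.
-/
theorem contDiffOn_profile (hg : AdmissibleData m φ g) (s : SpinIdx (n + 1)) :
    ContDiffOn ℝ m (profile φ g s) (signOrdered s) := by
  have h : ContDiffOn ℝ m (profile φ g s)
      (⋃ π : {π : Equiv.Perm (Fin (n + 1)) // Compatible s π}, chamber π.1) := by
    refine contDiffOn_iUnion (fun _ => isClosed_chamber _) (fun _ => uniqueDiffOn_chamber _)
      (fun p => contDiffOn_profile_chamber hg p.2) ?_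
    rintro c ⟨π, hπ⟩ ⟨π', hπ'⟩ hc hc' i hi
    refine sorting_induction (P := fun π => iteratedFDerivWithin ℝ i (profile φ g s) (chamber π) c =
      iteratedFDerivWithin ℝ i (profile φ g s) (chamber π') c) hπ' hc' rfl ?_ hπ hc
    intro k σ hs h hs1 h1 _ hne ih
    rw [← ih]
    exact iteratedFDerivWithin_eq_of_contDiffOn_union (uniqueDiffOn_chamber _)
      (uniqueDiffOn_chamber _) (contDiffOn_profile_union hg hs hs1 hne) hi h h1
  refine h.mono fun c hc => Set.mem_iUnion.2 ⟨⟨Tuple.sort c, compatible_sort hc⟩, ?_⟩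
  exact Tuple.monotone_sort c

/-! ### The Dirac equations in components -/

theorem gamma_apply_self (μ a : Fin 2) : gamma μ a a = 0 := by
  fin_cases μ <;> fin_cases a <;> simp [gamma]

theorem gamma_zero_apply_rev (a : Fin 2) : gamma 0 a a.rev = 1 := by
  fin_cases a <;> simp [gamma]

theorem gamma_one_apply_rev (a : Fin 2) : gamma 1 a a.rev = sgn a := by
  fin_cases a <;> simp [gamma]

theorem gammaAt_mulVec {N : ℕ} (k : Fin N) (μ : Fin 2) (v : SpinSpace N) (s : SpinIdx N) :
    (gammaAt k μ *ᵥ v) s = gamma μ (s k) (s k).rev * v (Function.update s k (s k).rev) := by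
  rw [Matrix.mulVec, dotProduct, Fintype.sum_eq_single (Function.update s k (s k).rev)]
  · congr 1
    rw [gammaAt, tensorMatrix, Matrix.of_apply, Finset.prod_eq_single k]
    · simp
    · intro j _ hj
      simp [hj]
    · simp
  · intro s' hs'
    apply mul_eq_zero_of_left
    rw [gammaAt, tensorMatrix, Matrix.of_apply, Finset.prod_eq_zero_iff]
    by_contra! hcon
    apply hs'
    ext1 j
    have hj := hcon j (Finset.mem_univ j)
    by_cases hjk : j = k
    · subst hjk
      rw [Function.update_self] at hj ⊢
      have hne : s' j ≠ s j := by
        intro e; rw [e, gamma_apply_self] at hj; exact hj rfl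
      generalize s' j = a at *
      generalize s j = b at *
      fin_cases a <;> fin_cases b <;> simp_all
    · rw [Function.update_of_ne hjk] at hj ⊢
      by_contra hne
      exact hj (Matrix.one_apply_ne (Ne.symm hne))

theorem sgn_rev (a : Fin 2) : sgn a.rev = -sgn a := by fin_cases a <;> simp

/-- Both gamma matrices are off-diagonal, so each scalar equation concerns the component with the
`k`-th sign flipped. Renaming that component reverses the sign of the space derivative. -/
theorem solvesDirac_iff {N : ℕ} {ψ : Config N → SpinSpace N} :
    SolvesDirac ψ ↔ ∀ x ∈ S₁ N, ∀ k s,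
      partialDeriv k 0 ψ x s = sgn (s k) * partialDeriv k 1 ψ x s := by
  have h1 : ∀ x k, Complex.I • ∑ μ, gammaAt k μ *ᵥ partialDeriv k μ ψ x = 0 ↔
      ∀ s, partialDeriv k 0 ψ x (Function.update s k (s k).rev) +
        sgn (s k) * partialDeriv k 1 ψ x (Function.update s k (s k).rev) = 0 := by
    intro x k
    rw [smul_eq_zero_iff_right Complex.I_ne_zero, Fin.sum_univ_two, funext_iff]
    refine forall_congr' fun s => ?_
    rw [Pi.add_apply, gammaAt_mulVec, gammaAt_mulVec, gamma_zero_apply_rev, gamma_one_apply_rev,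
      one_mul, Pi.zero_apply]
  unfold SolvesDirac
  refine forall₂_congr fun x _ => forall_congr' fun k => ?_
  rw [h1]
  constructor
  · intro h s
    have := h (Function.update s k (s k).rev)
    simp only [Function.update_self, Fin.rev_rev, Function.update_idem, Function.update_eq_self,
      sgn_rev] at this
    push_cast at this
    linear_combination this
  · intro h s
    have := h (Function.update s k (s k).rev)
    rw [this, Function.update_self, sgn_rev]
    push_cast
    ring

/-! ### Existence -/

/-- The solution of the initial boundary value problem. -/
def solution (φ : Fin n → ℝ) (g : (Fin (n + 1) → ℝ) → SpinSpace (n + 1))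
    (x : Config (n + 1)) : SpinSpace (n + 1) :=
  fun s => profile φ g s (charValue s x)

theorem contDiff_charValue {N : ℕ} (s : SpinIdx N) {m : ℕ∞ω} :
    ContDiff ℝ m (charValue s : Config N → Fin N → ℝ) := by
  unfold charValue; fun_prop

theorem closure_S₁_mem_nhds {N : ℕ} {x : Config N} (hx : x ∈ S₁ N) : closure (S₁ N) ∈ 𝓝 x :=
  Filter.mem_of_superset ((isOpen_S₁ N).mem_nhds hx) subset_closure

theorem differentiableAt_of_contDiffOn {N : ℕ} {ψ : Config N → SpinSpace N} (hm : 1 ≤ m)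
    (hψ : ContDiffOn ℝ m ψ (closure (S₁ N))) {x : Config N} (hx : x ∈ S₁ N) :
    DifferentiableAt ℝ ψ x :=
  (hψ.contDiffAt (closure_S₁_mem_nhds hx)).differentiableAt (by
    have : m ≠ 0 := by omega
    exact_mod_cast this)

theorem contDiffOn_solution (hg : AdmissibleData m φ g) :
    ContDiffOn ℝ m (solution φ g) (closure (S₁ (n + 1))) :=
  contDiffOn_pi.2 fun s => (contDiffOn_profile hg s).comp (contDiff_charValue s).contDiffOn
    fun _ hx => charValue_mem_signOrdered hx s

/-- The direction in the plane of the `k`-th point along which `z + b t` is constant. -/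
def nullVec {N : ℕ} (k : Fin N) (b : Fin 2) : Config N :=
  Pi.single k (Pi.single 0 1) - sgn b • (Pi.single k (Pi.single 1 1) : Config N)

theorem fderiv_nullVec {N : ℕ} (ψ : Config N → SpinSpace N) (x : Config N) (k : Fin N)
    (s : SpinIdx N) : fderiv ℝ ψ x (nullVec k (s k)) s =
      partialDeriv k 0 ψ x s - sgn (s k) * partialDeriv k 1 ψ x s := by
  simp [nullVec, partialDeriv]

theorem charValue_add_smul_nullVec {N : ℕ} (s : SpinIdx N) (x : Config N) (k : Fin N) (t : ℝ) :
    charValue s (x + t • nullVec k (s k)) = charValue s x := by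
  ext j
  by_cases hj : j = k
  · subst hj
    have : sgn (s j) * sgn (s j) = 1 := by
      generalize s j = a
      fin_cases a <;> simp
    simp only [charValue, nullVec, Pi.add_apply, Pi.smul_apply, Pi.sub_apply, Pi.single_eq_same,
      smul_eq_mul]
    simp
    ring
  · simp [charValue, nullVec, hj]

/-- Each component is constant along the null directions that leave its characteristic values fixed.
-/
theorem solvesDirac_solution (hm : 1 ≤ m) (hg : AdmissibleData m φ g) :
    SolvesDirac (solution φ g) := by
  rw [solvesDirac_iff]
  intro x hx k s
  rw [← sub_eq_zero, ← fderiv_nullVec]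
  have hd := differentiableAt_of_contDiffOn hm (contDiffOn_solution hg) hx
  have h1 := (hd.hasFDerivAt.hasLineDerivAt (nullVec k (s k)))
  have h2 : HasDerivAt (fun t : ℝ => solution φ g (x + t • nullVec k (s k)) s)
      (fderiv ℝ (solution φ g) x (nullVec k (s k)) s) 0 := hasDerivAt_pi.1 h1 s
  have h3 : (fun t : ℝ => solution φ g (x + t • nullVec k (s k)) s) =
      fun _ => solution φ g x s := by
    ext t
    rw [solution, charValue_add_smul_nullVec]
    rfl
  rw [h3] at h2
  exact h2.unique (hasDerivAt_const _ _)

theorem solution_eq_branch (hg : AdmissibleData m φ g) {s : SpinIdx (n + 1)} {x : Config (n + 1)}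
    {π : Equiv.Perm (Fin (n + 1))} (hs : Compatible s π) (hx : charValue s x ∈ chamber π) :
    solution φ g x s = branch φ g s π (charValue s x) :=
  profile_eq_branch hg hs hx

theorem charValue_comp_adjSwap {k : Fin n} {x : Config (n + 1)} (hx : x k.castSucc = x k.succ)
    (s : SpinIdx (n + 1)) : charValue (s ∘ adjSwap k) x = charValue s x ∘ adjSwap k := by
  have : x ∘ adjSwap k = x := comp_adjSwap_eq_self hx
  ext j
  have hj : x (adjSwap k j) = x j := congrFun this j
  simp [charValue, hj]

/-- At a coincidence, exchanging the signs merely permutes the characteristic values, so `τ_k π`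
sorts the new ones. Both sides then evaluate `g` at the same point and spin index, and only the
phases differ. -/
theorem boundaryCondition_solution (hg : AdmissibleData m φ g) :
    BoundaryCondition φ (solution φ g) := by
  intro k x hx s h1 h0
  have hne : s k.castSucc ≠ s k.succ := by simp [h1, h0]
  set π := Tuple.sort (charValue s x) with hπ
  have hs : Compatible s π := compatible_sort (charValue_mem_signOrdered hx.1 s)
  have hc : charValue s x ∈ chamber π := Tuple.monotone_sort _
  have hc' : charValue (s ∘ adjSwap k) x ∈ chamber (adjSwap k * π) := by
    rw [charValue_comp_adjSwap hx.2, mem_chamber, comp_adjSwap_comp_mul]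
    exact hc
  rw [solution_eq_branch hg hs hc, solution_eq_branch hg (hs.adjSwap_mul hne) hc', branch, branch,
    charValue_comp_adjSwap hx.2, comp_adjSwap_comp_mul, comp_adjSwap_comp_mul,
    ← phaseFactor_adjSwap φ h1 h0, ← mul_assoc, phaseFactor_mul]

theorem solvesIBVP_solution (hm : 1 ≤ m) (hg : AdmissibleData m φ g) :
    SolvesIBVP m φ g (solution φ g) where
  smooth := contDiffOn_solution hg
  dirac := solvesDirac_solution hm hg
  boundary := boundaryCondition_solution hg
  initial z hz := by
    ext s
    have h : charValue s (atTimeZero z) ∈ chamber 1 := by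
      rw [charValue_atTimeZero]; exact hz
    rw [solution_eq_branch hg (compatible_one s) h, branch, charValue_atTimeZero]
    simp

end

section

variable {n m : ℕ} {φ : Fin n → ℝ} {g : (Fin (n + 1) → ℝ) → SpinSpace (n + 1)}

/-! ### The explicit formula -/

theorem explicitFormulaAt_solution (φ : Fin n → ℝ) (g : (Fin (n + 1) → ℝ) → SpinSpace (n + 1))
    {s : SpinIdx (n + 1)} {x : Config (n + 1)} (hx : x ∈ distinctSet s) :
    ExplicitFormulaAt φ g (solution φ g) s x := by
  have hc := charValue_mem_signOrdered hx.1 s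
  have hmono : StrictMono (charValue s x ∘ Tuple.sort (charValue s x)) :=
    (Tuple.monotone_sort _).strictMono_of_injective
      (hx.2.comp (Tuple.sort (charValue s x)).injective)
  have hs : Compatible s (Tuple.sort (charValue s x)) := compatible_sort hc
  exact ⟨_, _, hmono, fun π' h' => eq_of_strictMono_comp h' hmono, hs.isPhase φ,
    fun θ' hθ' => hθ'.eq_of_compatible hs, rfl⟩

theorem charValue_add_smul_spread {N : ℕ} (s : SpinIdx N) (x : Config N) (ε : ℝ) (k : Fin N) :
    charValue s (x + ε • spreadConfig N) k = charValue s x k + ε * (k : ℝ) := by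
  rw [charValue_apply, nullCoord_add_smul, spreadConfig, nullCoord_atTimeZero, charValue_apply]

/-- Under the shift by `ε` the value `c_k` becomes `c_k + ε k`: equal values separate for every `ε >
0`, different ones stay apart for small `ε`. -/
theorem mem_closure_distinctSet {N : ℕ} (s : SpinIdx N) {x : Config N}
    (hx : x ∈ closure (S₁ N)) : x ∈ closure (distinctSet s) := by
  refine mem_closure_of_tendsto (tendsto_add_smul x (spreadConfig N)) ?_
  have hinj : ∀ᶠ ε : ℝ in 𝓝[>] 0, ∀ p : Fin N × Fin N, p.1 ≠ p.2 →
      charValue s x p.1 + ε * (p.1 : ℝ) ≠ charValue s x p.2 + ε * (p.2 : ℝ) := by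
    rw [Filter.eventually_all]
    rintro ⟨i, j⟩
    by_cases hij : i = j
    · exact Filter.Eventually.of_forall fun ε h => absurd hij h
    by_cases hc : charValue s x i = charValue s x j
    · filter_upwards [self_mem_nhdsWithin] with ε hε _ h
      rw [hc, add_right_inj] at h
      have h2 := mul_left_cancel₀ (ne_of_gt hε) h
      exact hij (Fin.ext (by exact_mod_cast h2))
    · have hcont : Continuous fun ε : ℝ =>
          (charValue s x i + ε * (i : ℝ)) - (charValue s x j + ε * (j : ℝ)) := by fun_prop
      have hne := hcont.continuousAt.eventually_ne (x := 0) (y := 0) (by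
        simpa [sub_eq_zero] using hc)
      filter_upwards [nhdsWithin_le_nhds hne] with ε hε _ h
      exact hε (sub_eq_zero.2 h)
  filter_upwards [self_mem_nhdsWithin, hinj] with ε hε hinj
  refine ⟨subset_closure (add_smul_spread_mem_S₁ (mem_closure_S₁_iff.1 hx) hε), ?_⟩
  intro i j hij
  by_contra hne
  rw [charValue_add_smul_spread, charValue_add_smul_spread] at hij
  exact hinj (i, j) hne hij

theorem tendsto_distinctSet {N : ℕ} {ψ : Config N → SpinSpace N}
    (hψ : ContinuousOn ψ (closure (S₁ N))) (s : SpinIdx N) {x : Config N}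
    (hx : x ∈ closure (S₁ N)) :
    Filter.Tendsto (fun y => ψ y s) (𝓝[distinctSet s] x) (𝓝 (ψ x s)) :=
  tendsto_pi_nhds.1 ((hψ x hx).mono fun _ hy => hy.1) s

/-! ### Uniqueness -/

theorem nullCoord_lineMap {N : ℕ} (b : Fin 2) (x y : Config N) (t : ℝ) (k : Fin N) :
    nullCoord b (x + t • (y - x)) k = (1 - t) * nullCoord b x k + t * nullCoord b y k := by
  simp [nullCoord]; ring

theorem segment_mem_S₁ {N : ℕ} {x y : Config N} (hx : x ∈ S₁ N) (hy : y ∈ S₁ N) {t : ℝ}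
    (ht : t ∈ Set.Icc (0 : ℝ) 1) : x + t • (y - x) ∈ S₁ N := by
  rw [mem_S₁_iff] at hx hy ⊢
  intro b j k hjk
  rw [nullCoord_lineMap, nullCoord_lineMap]
  have h1 := hx b hjk
  have h2 := hy b hjk
  rcases ht.1.eq_or_lt with rfl | h0
  · linarith
  · nlinarith [ht.2, mul_lt_mul_of_pos_left h2 h0,
      mul_le_mul_of_nonneg_left h1.le (sub_nonneg.2 ht.2)]

/-- Vanishing characteristic values determine each spatial part from the time part, which gives the
coefficients. -/
theorem eq_sum_nullVec {N : ℕ} {s : SpinIdx N} {v : Config N} (hv : charValue s v = 0) :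
    v = ∑ k, v k 0 • nullVec k (s k) := by
  ext j i
  rw [Finset.sum_apply, Finset.sum_apply, Finset.sum_eq_single j]
  · have h := congrFun hv j
    simp only [charValue, Pi.zero_apply] at h
    fin_cases i
    · simp [nullVec]
    · simp [nullVec]
      linarith
  · intro k _ hk
    simp [nullVec, hk.symm]
  · simp

theorem SolvesDirac.fderiv_eq_zero {N : ℕ} {ψ : Config N → SpinSpace N} (hD : SolvesDirac ψ)
    {x : Config N} (hx : x ∈ S₁ N) {s : SpinIdx N} {v : Config N} (hv : charValue s v = 0) :
    fderiv ℝ ψ x v s = 0 := by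
  rw [eq_sum_nullVec hv, map_sum, Finset.sum_apply]
  refine Finset.sum_eq_zero fun k _ => ?_
  rw [map_smul, Pi.smul_apply, fderiv_nullVec, solvesDirac_iff.1 hD _ hx k s, sub_self, smul_zero]

theorem eq_of_charValue_eq_of_mem_S₁ {N : ℕ} {ψ : Config N → SpinSpace N} (hm : 1 ≤ m)
    (hψ : ContDiffOn ℝ m ψ (closure (S₁ N))) (hD : SolvesDirac ψ) {s : SpinIdx N} {x y : Config N}
    (hx : x ∈ S₁ N) (hy : y ∈ S₁ N) (hxy : charValue s x = charValue s y) : ψ x s = ψ y s := by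
  have hv : charValue s (y - x) = 0 := by
    ext k
    have := congrFun hxy k
    simp only [charValue, Pi.sub_apply, Pi.zero_apply] at this ⊢
    linarith
  have hderiv : ∀ t ∈ Set.Icc (0 : ℝ) 1,
      HasDerivAt (fun t : ℝ => ψ (x + t • (y - x)) s) 0 t := by
    intro t ht
    have hp := segment_mem_S₁ hx hy ht
    have hd := (differentiableAt_of_contDiffOn hm hψ hp).hasFDerivAt
    have hl : HasDerivAt (fun t : ℝ => x + t • (y - x)) (y - x) t := by
      simpa using ((hasDerivAt_id t).smul_const (y - x)).const_add x
    have h1 := hasDerivAt_pi.1 (hd.comp_hasDerivAt t hl) s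
    rwa [hD.fderiv_eq_zero hp hv] at h1
  have := constant_of_has_deriv_right_zero
    (fun t ht => (hderiv t ht).continuousAt.continuousWithinAt)
    (fun t ht => (hderiv t ⟨ht.1, ht.2.le⟩).hasDerivWithinAt) 1 (Set.right_mem_Icc.2 zero_le_one)
  simpa using this.symm

/-- The same shift moves `x` and `y` into `S₁` and changes their characteristic values equally; the
claim follows in the limit. -/
theorem eq_of_charValue_eq {N : ℕ} {ψ : Config N → SpinSpace N} (hm : 1 ≤ m)
    (hψ : ContDiffOn ℝ m ψ (closure (S₁ N))) (hD : SolvesDirac ψ) {s : SpinIdx N} {x y : Config N}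
    (hx : x ∈ closure (S₁ N)) (hy : y ∈ closure (S₁ N)) (hxy : charValue s x = charValue s y) :
    ψ x s = ψ y s := by
  have key : ∀ x ∈ closure (S₁ N), Filter.Tendsto (fun ε : ℝ => ψ (x + ε • spreadConfig N) s)
      (𝓝[>] 0) (𝓝 (ψ x s)) := by
    intro x hx
    refine (tendsto_pi_nhds.1 (hψ.continuousOn x hx) s).comp ?_
    refine tendsto_nhdsWithin_iff.2 ⟨tendsto_add_smul x _, ?_⟩
    filter_upwards [self_mem_nhdsWithin] with ε hε
    exact subset_closure (add_smul_spread_mem_S₁ (mem_closure_S₁_iff.1 hx) hε)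
  refine tendsto_nhds_unique ((key x hx).congr' ?_) (key y hy)
  filter_upwards [self_mem_nhdsWithin] with ε hε
  refine eq_of_charValue_eq_of_mem_S₁ hm hψ hD
    (add_smul_spread_mem_S₁ (mem_closure_S₁_iff.1 hx) hε)
    (add_smul_spread_mem_S₁ (mem_closure_S₁_iff.1 hy) hε) ?_
  ext k
  rw [charValue_add_smul_spread, charValue_add_smul_spread, hxy]

/-- The configuration with given null coordinates. -/
def ofNullCoord {N : ℕ} (w : Fin 2 → Fin N → ℝ) : Config N :=
  fun k => ![(w 1 k - w 0 k) / 2, (w 1 k + w 0 k) / 2]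

theorem nullCoord_ofNullCoord {N : ℕ} (w : Fin 2 → Fin N → ℝ) (b : Fin 2) :
    nullCoord b (ofNullCoord w) = w b := by
  ext k
  fin_cases b <;> simp [nullCoord, ofNullCoord] <;> ring

/-- Values on the positions of one sign extend monotonically to all positions, with equal values at
two neighbours of opposite signs. -/
theorem exists_monotone_extension_of_ne {s : SpinIdx (n + 1)} {c : Fin (n + 1) → ℝ}
    (hc : c ∈ signOrdered s) {k : Fin n} (hk : s k.castSucc ≠ s k.succ) (b : Fin 2) :
    ∃ w : Fin (n + 1) → ℝ, Monotone w ∧ (∀ j, s j = b → w j = c j) ∧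
      w k.castSucc = w k.succ := by
  have hmono : MonotoneOn c {j | s j = b} := by
    intro i hi j hj hij
    rcases hij.eq_or_lt with rfl | hij
    · exact le_rfl
    · exact hc i j hij (hi.trans hj.symm)
  obtain ⟨w, hw, hwc⟩ := hmono.exists_monotone_extension
    (Set.toFinite _).bddBelow (Set.toFinite _).bddAbove
  -- Only one of the two neighbours has sign `b`. Its value is copied to the other one, where
  -- nothing is prescribed.
  by_cases hb : s k.castSucc = b
  · refine ⟨fun j => w (if j = k.succ then k.castSucc else j), fun i j hij => hw ?_, ?_, ?_⟩
    · split_ifs with h1 h2 h2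
      · exact le_rfl
      · exact Fin.castSucc_lt_succ.le.trans (h1 ▸ hij)
      · subst h2
        exact Fin.le_castSucc_iff.2 (lt_of_le_of_ne hij h1)
      · exact hij
    · intro j hj
      have : j ≠ k.succ := by
        rintro rfl
        exact hk (hb.trans hj.symm)
      simp only [if_neg this]
      exact (hwc hj).symm
    · simp [Fin.castSucc_lt_succ.ne]
  · refine ⟨fun j => w (if j = k.castSucc then k.succ else j), fun i j hij => hw ?_, ?_, ?_⟩
    · split_ifs with h1 h2 h2
      · exact le_rfl
      · subst h1
        exact Fin.castSucc_lt_iff_succ_le.1 (lt_of_le_of_ne hij (Ne.symm h2))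
      · exact (h2 ▸ hij).trans Fin.castSucc_lt_succ.le
      · exact hij
    · intro j hj
      have : j ≠ k.castSucc := by
        rintro rfl
        exact hb hj
      simp only [if_neg this]
      exact (hwc hj).symm
    · simp [Fin.castSucc_lt_succ.ne']

/-- Each `c_j` prescribes only the null coordinate of sign `s_j` of the `j`-th point. Opposite signs
at `k`, `k + 1` leave room to make both null coordinates agree there. -/
theorem exists_coincidence_of_ne {s : SpinIdx (n + 1)} {c : Fin (n + 1) → ℝ}
    (hc : c ∈ signOrdered s) {k : Fin n} (hk : s k.castSucc ≠ s k.succ) :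
    ∃ x ∈ coincidence k, charValue s x = c := by
  choose w hw hwc hwk using exists_monotone_extension_of_ne hc hk
  refine ⟨ofNullCoord w, ⟨mem_closure_S₁_iff.2 fun b => ?_, ?_⟩, ?_⟩
  · rw [nullCoord_ofNullCoord]; exact hw b
  · simp only [ofNullCoord, hwk]
  · ext j
    rw [charValue_apply, nullCoord_ofNullCoord, hwc _ j rfl]

/-- Without collisions, the point is joined to the initial surface at constant characteristic
values. Otherwise it is joined to a coincidence of a descent, where the boundary condition passes to
a component with fewer collisions. -/
theorem SolvesIBVP.eq_branch {ψ : Config (n + 1) → SpinSpace (n + 1)} (hm : 1 ≤ m)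
    (hψ : SolvesIBVP m φ g ψ) {s : SpinIdx (n + 1)} {π : Equiv.Perm (Fin (n + 1))}
    (hs : Compatible s π) : ∀ x ∈ closure (S₁ (n + 1)), charValue s x ∈ chamber π →
      ψ x s = branch φ g s π (charValue s x) := by
  refine Compatible.induction (P := fun s π => ∀ x ∈ closure (S₁ (n + 1)),
    charValue s x ∈ chamber π → ψ x s = branch φ g s π (charValue s x)) ?_ ?_ hs
  · intro s x hx hc
    have hc : Monotone (charValue s x) := hc
    have hz : atTimeZero (charValue s x) ∈ closure (S₁ (n + 1)) :=
      mem_closure_S₁_iff.2 fun b => by rwa [nullCoord_atTimeZero]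
    rw [eq_of_charValue_eq hm hψ.smooth hψ.dirac hx hz (charValue_atTimeZero s _).symm,
      hψ.initial _ hc, branch]
    simp
  · intro k π s hs hne _ ih x hx hc
    obtain ⟨y, hy, hyx⟩ := exists_coincidence_of_ne (charValue_mem_signOrdered hx s) hne
    have hc' : charValue (s ∘ adjSwap k) y ∈ chamber (adjSwap k * π) := by
      rw [charValue_comp_adjSwap hy.2, mem_chamber, comp_adjSwap_comp_mul, hyx]
      exact hc
    rw [eq_of_charValue_eq hm hψ.smooth hψ.dirac hx hy.1 hyx.symm,
      eq_phaseFactor_mul_of_ne (G := ψ y) (hψ.boundary k y hy) hne, ih y hy.1 hc', branch, branch,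
      charValue_comp_adjSwap hy.2, comp_adjSwap_comp_mul, comp_adjSwap_comp_mul, ← mul_assoc,
      phaseFactor_mul, hyx]

theorem SolvesIBVP.eqOn_solution {ψ : Config (n + 1) → SpinSpace (n + 1)} (hm : 1 ≤ m)
    (hψ : SolvesIBVP m φ g ψ) : Set.EqOn ψ (solution φ g) (closure (S₁ (n + 1))) := by
  intro x hx
  ext s
  exact hψ.eq_branch hm (compatible_sort (charValue_mem_signOrdered hx s)) x hx
    (Tuple.monotone_sort _)

end

section

open MeasureTheory
open scoped ENNReal

/-! ### The density of the current form on a surface -/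

theorem tensorMatrix_mul {N : ℕ} (A B : Fin N → Matrix (Fin 2) (Fin 2) ℂ) :
    tensorMatrix A * tensorMatrix B = tensorMatrix fun k => A k * B k := by
  ext s s'
  simp only [tensorMatrix, Matrix.mul_apply, Matrix.of_apply, ← Finset.prod_mul_distrib]
  rw [Finset.prod_univ_sum, Fintype.piFinset_univ]

theorem tensorMatrix_diagonal {N : ℕ} (d : Fin N → Fin 2 → ℂ) :
    (tensorMatrix fun k => Matrix.diagonal (d k)) =
      Matrix.diagonal fun s : SpinIdx N => ∏ k, d k (s k) := by
  ext s s'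
  rw [tensorMatrix, Matrix.of_apply]
  by_cases h : s = s'
  · subst h
    rw [Matrix.diagonal_apply_eq]
    exact Finset.prod_congr rfl fun k _ => Matrix.diagonal_apply_eq _ _
  · rw [Matrix.diagonal_apply_ne _ h]
    obtain ⟨k, hk⟩ := Function.ne_iff.1 h
    exact Finset.prod_eq_zero (Finset.mem_univ k) (Matrix.diagonal_apply_ne _ hk)

/-- The diagonal entries of `γ⁰ γ^μ`. -/
def currentEntry (μ a : Fin 2) : ℂ := if μ = 0 then 1 else -(sgn a : ℂ)

theorem gamma_zero_mul_gamma (μ : Fin 2) :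
    gamma 0 * gamma μ = Matrix.diagonal (currentEntry μ) := by
  ext a b
  fin_cases μ <;> fin_cases a <;> fin_cases b <;>
    simp [gamma, currentEntry, Matrix.mul_apply, Fin.sum_univ_two]

theorem current_eq {N : ℕ} (Ψ : SpinSpace N) (μ : Fin N → Fin 2) :
    current Ψ μ = ∑ s, ((‖Ψ s‖ ^ 2 : ℝ) : ℂ) * ∏ k, currentEntry (μ k) (s k) := by
  rw [current, ← Matrix.dotProduct_mulVec, Matrix.mulVec_mulVec, tensorMatrix_mul]
  simp only [gamma_zero_mul_gamma]
  rw [tensorMatrix_diagonal, dotProduct]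
  refine Finset.sum_congr rfl fun s _ => ?_
  rw [Matrix.mulVec_diagonal, Pi.star_apply, Complex.ofReal_pow, ← Complex.conj_mul']
  simp only [RCLike.star_def]
  ring

theorem surfaceDensity_eq {N : ℕ} (ψ : Config N → SpinSpace N) (f : ℝ → ℝ) (z : Fin N → ℝ) :
    surfaceDensity ψ f z = ((∑ s, ‖ψ (surfacePoint f z) s‖ ^ 2 *
      ∏ k, (1 + sgn (s k) * deriv f (z k)) : ℝ) : ℂ) := by
  -- The `l`-th tangent vector moves only the `l`-th particle, so the matrix is diagonal.
  have hdet : ∀ μ : Fin N → Fin 2,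
      (Matrix.of fun k l => surfaceTangent f z l k (μ k).rev).det =
        ∏ k, (![deriv f (z k), 1] : Fin 2 → ℝ) (μ k).rev := by
    intro μ
    rw [← Matrix.det_diagonal]
    congr 1
    ext k l
    rw [Matrix.of_apply, surfaceTangent]
    by_cases h : k = l
    · subst h; simp
    · simp [h]
  rw [surfaceDensity, currentForm]
  simp only [hdet, current_eq]
  set Ψ := ψ (surfacePoint f z)
  have h1 : ∀ μ : Fin N → Fin 2, (-1) ^ (∑ k, (μ k : ℕ)) *
      (∑ s, ((‖Ψ s‖ ^ 2 : ℝ) : ℂ) * ∏ k, currentEntry (μ k) (s k)) *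
      ((∏ k, (![deriv f (z k), 1] : Fin 2 → ℝ) (μ k).rev : ℝ) : ℂ) =
      ∑ s, ((‖Ψ s‖ ^ 2 : ℝ) : ℂ) * ∏ k, ((-1) ^ (μ k : ℕ) * currentEntry (μ k) (s k) *
        (((![deriv f (z k), 1] : Fin 2 → ℝ) (μ k).rev : ℝ) : ℂ)) := by
    intro μ
    rw [Finset.mul_sum, Finset.sum_mul]
    refine Finset.sum_congr rfl fun s _ => ?_
    rw [Finset.prod_mul_distrib, Finset.prod_mul_distrib, Finset.prod_pow_eq_pow_sum,
      Complex.ofReal_prod]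
    ring
  simp only [h1]
  rw [Finset.sum_comm, Complex.ofReal_sum]
  refine Finset.sum_congr rfl fun s _ => ?_
  rw [← Finset.mul_sum, Complex.ofReal_mul, Complex.ofReal_prod]
  congr 1
  -- The sum over all `μ` factorizes over the particles; `μ_k = 0` contributes `1` and `μ_k = 1`
  -- contributes `s_k f'(z_k)`.
  have h2 := Finset.prod_univ_sum (fun _ : Fin N => (Finset.univ : Finset (Fin 2)))
    (fun k μ => (-1) ^ (μ : ℕ) * currentEntry μ (s k) *
      (((![deriv f (z k), 1] : Fin 2 → ℝ) μ.rev : ℝ) : ℂ))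
  rw [Fintype.piFinset_univ] at h2
  rw [← h2]
  refine Finset.prod_congr rfl fun k _ => ?_
  simp [Fin.sum_univ_two, currentEntry]

/-! ### Characteristic values on a surface -/

variable {f : ℝ → ℝ}

/-- The null coordinate of the point at position `t` of the graph of `f`. -/
def nullGraph (f : ℝ → ℝ) (b : Fin 2) (t : ℝ) : ℝ := t + sgn b * f t

theorem nullCoord_surfacePoint {N : ℕ} (f : ℝ → ℝ) (b : Fin 2) (z : Fin N → ℝ) (k : Fin N) :
    nullCoord b (surfacePoint f z) k = nullGraph f b (z k) := by
  simp [nullCoord, surfacePoint, nullGraph]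

theorem charValue_surfacePoint {N : ℕ} (f : ℝ → ℝ) (s : SpinIdx N) (z : Fin N → ℝ) (k : Fin N) :
    charValue s (surfacePoint f z) k = nullGraph f (s k) (z k) :=
  nullCoord_surfacePoint f (s k) z k

theorem IsSpacelikeCauchy.hasDerivAt (hf : IsSpacelikeCauchy f) (b : Fin 2) (t : ℝ) :
    HasDerivAt (nullGraph f b) (1 + sgn b * deriv f t) t :=
  (hasDerivAt_id t).add
    ((hf.smooth.differentiable (by simp) t).hasDerivAt.const_mul (sgn b))

theorem IsSpacelikeCauchy.deriv_pos (hf : IsSpacelikeCauchy f) (b : Fin 2) (t : ℝ) :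
    0 < 1 + sgn b * deriv f t := by
  have := abs_lt.1 (hf.spacelike t)
  fin_cases b <;> simp <;> linarith [this.1, this.2]

theorem IsSpacelikeCauchy.strictMono (hf : IsSpacelikeCauchy f) (b : Fin 2) :
    StrictMono (nullGraph f b) :=
  strictMono_of_hasDerivAt_pos (hf.hasDerivAt b) (hf.deriv_pos b)

theorem IsSpacelikeCauchy.surjective (hf : IsSpacelikeCauchy f) (b : Fin 2) :
    Function.Surjective (nullGraph f b) := by
  intro c
  fin_cases b
  · obtain ⟨z, hz⟩ := hf.right c
    exact ⟨z, by simp [nullGraph]; linarith⟩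
  · obtain ⟨z, hz⟩ := hf.left c
    exact ⟨z, by simp [nullGraph]; linarith⟩

theorem IsSpacelikeCauchy.continuous (hf : IsSpacelikeCauchy f) : Continuous f :=
  hf.smooth.continuous

theorem IsSpacelikeCauchy.continuous_deriv (hf : IsSpacelikeCauchy f) : Continuous (deriv f) :=
  hf.smooth.continuous_deriv (by simp)

theorem IsSpacelikeCauchy.surfaceDomain_eq (hf : IsSpacelikeCauchy f) (N : ℕ) :
    surfaceDomain N f = {z | StrictMono z} := by
  ext z
  change surfacePoint f z ∈ S₁ N ↔ StrictMono z
  rw [mem_S₁_iff]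
  constructor
  · intro h i j hij
    have := h 0 hij
    rw [nullCoord_surfacePoint, nullCoord_surfacePoint] at this
    exact (hf.strictMono 0).lt_iff_lt.1 this
  · intro h b i j hij
    rw [nullCoord_surfacePoint, nullCoord_surfacePoint]
    exact hf.strictMono b (h hij)

/-- The Jacobian determinant of the characteristic values on a surface. -/
def jacobian {N : ℕ} (f : ℝ → ℝ) (s : SpinIdx N) (z : Fin N → ℝ) : ℝ :=
  ∏ k, (1 + sgn (s k) * deriv f (z k))

theorem IsSpacelikeCauchy.jacobian_pos (hf : IsSpacelikeCauchy f) {N : ℕ} (s : SpinIdx N)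
    (z : Fin N → ℝ) : 0 < jacobian f s z :=
  Finset.prod_pos fun _ _ => hf.deriv_pos _ _

theorem IsSpacelikeCauchy.continuous_jacobian (hf : IsSpacelikeCauchy f) {N : ℕ} (s : SpinIdx N) :
    Continuous (jacobian f s) := by
  have := hf.continuous_deriv
  unfold jacobian
  fun_prop

theorem IsSpacelikeCauchy.continuous_surfacePoint (hf : IsSpacelikeCauchy f) {N : ℕ} :
    Continuous (surfacePoint f : (Fin N → ℝ) → Config N) := by
  have := hf.continuous
  refine continuous_pi fun k => continuous_pi fun i => ?_
  fin_cases i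
  · exact this.comp (continuous_apply k)
  · exact continuous_apply k

theorem continuous_charValue {N : ℕ} (s : SpinIdx N) :
    Continuous (charValue s : Config N → Fin N → ℝ) :=
  (contDiff_charValue s (m := 0)).continuous

/-- The map acts on each coordinate by an increasing bijection of `ℝ`: space-like tangents give a
positive derivative, and meeting every light-like line gives surjectivity. -/
theorem IsSpacelikeCauchy.lintegral_charValue (hf : IsSpacelikeCauchy f) {N : ℕ} (s : SpinIdx N)
    (h : (Fin N → ℝ) → ℝ≥0∞) :
    ∫⁻ z, ENNReal.ofReal (jacobian f s z) * h (charValue s (surfacePoint f z)) = ∫⁻ c, h c := by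
  set F : (Fin N → ℝ) → (Fin N → ℝ) := fun z => charValue s (surfacePoint f z) with hF
  have hFk : ∀ z k, F z k = nullGraph f (s k) (z k) := charValue_surfacePoint f s
  let F' : (Fin N → ℝ) → (Fin N → ℝ) →L[ℝ] (Fin N → ℝ) := fun z =>
    ContinuousLinearMap.pi fun k =>
      ((1 + sgn (s k) * deriv f (z k)) • ContinuousLinearMap.id ℝ ℝ).comp
        (ContinuousLinearMap.proj k)
  have hdet : ∀ z, (F' z).det = jacobian f s z := by
    intro z
    simp only [F']
    rw [ContinuousLinearMap.det_pi]
    refine Finset.prod_congr rfl fun k _ => ?_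
    simp [ContinuousLinearMap.det]
  have hderiv : ∀ z ∈ (Set.univ : Set (Fin N → ℝ)), HasFDerivWithinAt F (F' z) Set.univ z := by
    intro z _
    rw [hasFDerivWithinAt_univ, hasFDerivAt_pi']
    intro k
    have h0 : HasFDerivAt (fun z : Fin N → ℝ => z k)
        (ContinuousLinearMap.proj k : (Fin N → ℝ) →L[ℝ] ℝ) z := hasFDerivAt_apply k z
    have h1 := (hf.hasDerivAt (s k) (z k)).comp_hasFDerivAt z h0
    exact (h1.congr_fderiv (by ext; simp [F'])).congr_of_eventuallyEq
      (Filter.Eventually.of_forall fun z => hFk z k)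
  have hinj : Function.Injective F := by
    intro z z' h
    ext k
    have := congrFun h k
    rw [hFk, hFk] at this
    exact (hf.strictMono (s k)).injective this
  have hsurj : F '' Set.univ = Set.univ := by
    rw [Set.image_univ, Set.range_eq_univ]
    intro c
    choose z hz using fun k => hf.surjective (s k) (c k)
    exact ⟨z, funext fun k => (hFk z k).trans (hz k)⟩
  have := lintegral_image_eq_lintegral_abs_det_fderiv_mul volume MeasurableSet.univ hderiv
    hinj.injOn h
  rw [hsurj, Measure.restrict_univ] at this
  rw [this]
  refine lintegral_congr fun z => ?_
  rw [hdet, abs_of_pos (hf.jacobian_pos s z)]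

/-! ### Coincidences of the characteristic values are negligible -/

theorem measurableSet_not_injective (N : ℕ) :
    MeasurableSet {c : Fin N → ℝ | ¬Function.Injective c} := by
  have : {c : Fin N → ℝ | ¬Function.Injective c} =
      ⋃ i : Fin N, ⋃ j : Fin N, ⋃ _ : i ≠ j, {c | c i = c j} := by
    ext c
    simp [Function.Injective, and_comm]
  rw [this]
  refine .iUnion fun i => .iUnion fun j => .iUnion fun _ => ?_
  exact measurableSet_eq_fun (measurable_pi_apply i) (measurable_pi_apply j)

theorem volume_not_injective (N : ℕ) :
    volume {c : Fin N → ℝ | ¬Function.Injective c} = 0 := by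
  have : {c : Fin N → ℝ | ¬Function.Injective c} ⊆
      ⋃ i : Fin N, ⋃ j : Fin N, ⋃ _ : i ≠ j, {c | c i = c j} := by
    intro c hc
    simp only [Set.mem_iUnion]
    obtain ⟨i, j, h, hne⟩ := Function.not_injective_iff.1 hc
    exact ⟨i, j, hne, h⟩
  refine measure_mono_null this (measure_iUnion_null fun i => measure_iUnion_null fun j =>
    measure_iUnion_null fun hij => ?_)
  let L : (Fin N → ℝ) →ₗ[ℝ] ℝ :=
    LinearMap.proj (R := ℝ) (φ := fun _ => ℝ) i - LinearMap.proj (R := ℝ) (φ := fun _ => ℝ) j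
  have hset : {c : Fin N → ℝ | c i = c j} = (LinearMap.ker L : Set (Fin N → ℝ)) := by
    ext c
    simp [L, sub_eq_zero]
  rw [hset]
  refine Measure.addHaar_submodule volume _ fun htop => ?_
  -- The `i`-th unit vector is not in the kernel, so the hyperplane is proper.
  have hmem : (Pi.single i 1 : Fin N → ℝ) ∈ LinearMap.ker L := htop ▸ Submodule.mem_top
  simp [L, hij.symm] at hmem

/-- The change of variables is applied to the indicator of the null set of coincident values; a
positive Jacobian forces the preimage to be null. -/
theorem IsSpacelikeCauchy.ae_injective (hf : IsSpacelikeCauchy f) {N : ℕ} (s : SpinIdx N) :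
    ∀ᵐ z : Fin N → ℝ, Function.Injective (charValue s (surfacePoint f z)) := by
  have hmeas : Measurable fun z : Fin N → ℝ => charValue s (surfacePoint f z) :=
    ((continuous_charValue s).comp hf.continuous_surfacePoint).measurable
  have h := hf.lintegral_charValue s ({c : Fin N → ℝ | ¬Function.Injective c}.indicator 1)
  rw [lintegral_indicator_one (measurableSet_not_injective N), volume_not_injective,
    lintegral_eq_zero_iff] at h
  · filter_upwards [h] with z hz
    by_contra hcon
    have h1 : ENNReal.ofReal (jacobian f s z) ≠ 0 := by
      simpa using hf.jacobian_pos s z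
    have hmem : charValue s (surfacePoint f z) ∈ {c : Fin N → ℝ | ¬Function.Injective c} := hcon
    rw [Set.indicator_of_mem hmem] at hz
    simp at hz
    exact absurd (hf.jacobian_pos s z) (not_lt.2 hz)
  · exact (hf.continuous_jacobian s).measurable.ennreal_ofReal.mul
      ((measurable_one.indicator (measurableSet_not_injective N)).comp hmeas)

/-! ### The symmetric weight -/

/-- The probability density of the initial data, continued symmetrically to all orders of the
particles. -/
def weight {N : ℕ} (g : (Fin N → ℝ) → SpinSpace N) (s : SpinIdx N) (c : Fin N → ℝ) : ℝ≥0∞ :=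
  ∑ π : Equiv.Perm (Fin N),
    {c : Fin N → ℝ | StrictMono (c ∘ π)}.indicator (fun c => ‖g (c ∘ π) (s ∘ π)‖ₑ ^ 2) c

theorem weight_eq {N : ℕ} {g : (Fin N → ℝ) → SpinSpace N} {s : SpinIdx N} {c : Fin N → ℝ}
    {π : Equiv.Perm (Fin N)} (h : StrictMono (c ∘ π)) :
    weight g s c = ‖g (c ∘ π) (s ∘ π)‖ₑ ^ 2 := by
  rw [weight, Fintype.sum_eq_single π]
  · exact Set.indicator_of_mem (s := {c : Fin N → ℝ | StrictMono (c ∘ π)}) h _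
  · intro π' hne
    exact Set.indicator_of_notMem (s := {c : Fin N → ℝ | StrictMono (c ∘ π')})
      (fun h' => hne (eq_of_strictMono_comp h' h)) _

theorem weight_comp {N : ℕ} (g : (Fin N → ℝ) → SpinSpace N) (s : SpinIdx N) (c : Fin N → ℝ)
    (σ : Equiv.Perm (Fin N)) : weight g (s ∘ σ) (c ∘ σ) = weight g s c := by
  exact Equiv.sum_comp (Equiv.mulLeft σ) fun π =>
    {c : Fin N → ℝ | StrictMono (c ∘ π)}.indicator (fun c => ‖g (c ∘ π) (s ∘ π)‖ₑ ^ 2) c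

theorem measurable_weight {N : ℕ} {g : (Fin N → ℝ) → SpinSpace N}
    (hg : ContinuousOn g (ordered N)) (s : SpinIdx N) : Measurable (weight g s) := by
  classical
  refine Finset.measurable_sum _ fun π _ => ?_
  rw [← Set.piecewise_eq_indicator]
  refine ContinuousOn.measurable_piecewise ?_ continuousOn_const
    (isOpen_strictMono_comp π).measurableSet
  have h1 : ContinuousOn (fun c : Fin N → ℝ => g (c ∘ π) (s ∘ π))
      {c : Fin N → ℝ | StrictMono (c ∘ π)} :=
    (continuousOn_pi.1 hg (s ∘ π)).comp (contDiff_comp_perm π (m := 0)).continuous.continuousOn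
      fun c hc => StrictMono.monotone hc
  exact (ENNReal.continuous_pow 2).comp_continuousOn h1.enorm

/-- The density on a surface, continued symmetrically to all positions. -/
def symmDensity {N : ℕ} (g : (Fin N → ℝ) → SpinSpace N) (f : ℝ → ℝ) (z : Fin N → ℝ) : ℝ≥0∞ :=
  ∑ s, ENNReal.ofReal (jacobian f s z) * weight g s (charValue s (surfacePoint f z))

/-- Relabelling the positions is absorbed by relabelling the spins in the sum; no single component
has this symmetry. -/
theorem symmDensity_comp {N : ℕ} (g : (Fin N → ℝ) → SpinSpace N) (f : ℝ → ℝ) (z : Fin N → ℝ)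
    (σ : Equiv.Perm (Fin N)) : symmDensity g f (z ∘ σ) = symmDensity g f z := by
  rw [symmDensity, symmDensity, ← Equiv.sum_comp (Equiv.arrowCongr σ.symm (Equiv.refl (Fin 2)))]
  refine Finset.sum_congr rfl fun s _ => ?_
  have h0 : Equiv.arrowCongr σ.symm (Equiv.refl (Fin 2)) s = s ∘ σ := rfl
  have h1 : jacobian f (s ∘ σ) (z ∘ σ) = jacobian f s z :=
    Equiv.prod_comp σ fun k => 1 + sgn (s k) * deriv f (z k)
  have h2 : charValue (s ∘ σ) (surfacePoint f (z ∘ σ)) = charValue s (surfacePoint f z) ∘ σ := rfl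
  rw [h0, h1, h2, weight_comp]

theorem IsSpacelikeCauchy.lintegral_symmDensity (hf : IsSpacelikeCauchy f) {N : ℕ}
    {g : (Fin N → ℝ) → SpinSpace N} (hg : ContinuousOn g (ordered N)) :
    ∫⁻ z, symmDensity g f z = ∑ s, ∫⁻ c, weight g s c := by
  unfold symmDensity
  rw [lintegral_finsetSum]
  · exact Finset.sum_congr rfl fun s _ => hf.lintegral_charValue s _
  · intro s _
    exact (hf.continuous_jacobian s).measurable.ennreal_ofReal.mul ((measurable_weight hg s).comp
      ((continuous_charValue s).comp hf.continuous_surfacePoint).measurable)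

/-- The integral of a symmetric function is `N!` times its integral over the ordered positions. -/
theorem lintegral_eq_factorial_mul {N : ℕ} {Q : (Fin N → ℝ) → ℝ≥0∞}
    (hQ : ∀ z (σ : Equiv.Perm (Fin N)), Q (z ∘ σ) = Q z) :
    ∫⁻ z, Q z = (N.factorial : ℝ≥0∞) * ∫⁻ z in {z | StrictMono z}, Q z := by
  have hpart : ∀ σ : Equiv.Perm (Fin N),
      ∫⁻ z in {z | StrictMono (z ∘ σ)}, Q z = ∫⁻ z in {z | StrictMono z}, Q z := by
    intro σ
    have hmp := volume_measurePreserving_piCongrLeft (fun _ : Fin N => ℝ) σ.symm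
    have hcoe : ∀ z, MeasurableEquiv.piCongrLeft (fun _ : Fin N => ℝ) σ.symm z = z ∘ σ := by
      intro z
      ext i
      simp [MeasurableEquiv.piCongrLeft, Equiv.piCongrLeft_apply]
    have := hmp.setLIntegral_comp_preimage_emb (MeasurableEquiv.measurableEmbedding _) Q
      {z | StrictMono z}
    simp only [hcoe, hQ] at this
    rw [← this]
    congr 2
    ext z
    change _ ↔ StrictMono _
    rw [hcoe]
    rfl
  have hunion : (⋃ σ : Equiv.Perm (Fin N), {z : Fin N → ℝ | StrictMono (z ∘ σ)}) =ᵐ[volume]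
      (Set.univ : Set (Fin N → ℝ)) := by
    rw [ae_eq_univ]
    refine measure_mono_null (t := {z : Fin N → ℝ | ¬Function.Injective z}) ?_
      (volume_not_injective N)
    intro z hz hinj
    refine hz (Set.mem_iUnion.2 ⟨Tuple.sort z, ?_⟩)
    exact (Tuple.monotone_sort z).strictMono_of_injective (hinj.comp (Tuple.sort z).injective)
  have hdisj : Pairwise (Function.onFun Disjoint
      fun σ : Equiv.Perm (Fin N) => {z : Fin N → ℝ | StrictMono (z ∘ σ)}) := by
    intro σ σ' hne
    exact Set.disjoint_left.2 fun z hz hz' => hne (eq_of_strictMono_comp hz hz')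
  rw [← setLIntegral_univ, ← setLIntegral_congr hunion,
    lintegral_iUnion (fun σ => (isOpen_strictMono_comp σ).measurableSet) hdisj, tsum_fintype]
  simp only [hpart]
  rw [Finset.sum_const, Finset.card_univ, Fintype.card_perm, Fintype.card_fin, nsmul_eq_mul]

/-! ### Conservation of probability -/

variable {n m : ℕ} {φ : Fin n → ℝ} {g : (Fin (n + 1) → ℝ) → SpinSpace (n + 1)}

theorem norm_phaseFactor (φ : Fin n → ℝ) (s w : SpinIdx (n + 1)) : ‖phaseFactor φ s w‖ = 1 := by
  rw [phaseFactor, mul_comm, Complex.norm_exp_ofReal_mul_I]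

theorem enorm_solution_sq {s : SpinIdx (n + 1)} {x : Config (n + 1)}
    (hx : Function.Injective (charValue s x)) :
    ‖solution φ g x s‖ₑ ^ 2 = weight g s (charValue s x) := by
  have hmono : StrictMono (charValue s x ∘ Tuple.sort (charValue s x)) :=
    (Tuple.monotone_sort _).strictMono_of_injective
      (hx.comp (Tuple.sort (charValue s x)).injective)
  rw [weight_eq hmono, solution, profile, branch, enorm_mul, ← ofReal_norm, norm_phaseFactor]
  simp

theorem IsSpacelikeCauchy.enorm_surfaceDensity (hf : IsSpacelikeCauchy f) {N : ℕ}
    (ψ : Config N → SpinSpace N) (z : Fin N → ℝ) :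
    ‖surfaceDensity ψ f z‖ₑ =
      ∑ s, ENNReal.ofReal (jacobian f s z) * ‖ψ (surfacePoint f z) s‖ₑ ^ 2 := by
  have hnn : ∀ s : SpinIdx N, 0 ≤ ‖ψ (surfacePoint f z) s‖ ^ 2 * jacobian f s z := fun s =>
    mul_nonneg (sq_nonneg _) (hf.jacobian_pos s z).le
  change ∀ s : SpinIdx N, 0 ≤ ‖ψ (surfacePoint f z) s‖ ^ 2 *
    ∏ k, (1 + sgn (s k) * deriv f (z k)) at hnn
  rw [surfaceDensity_eq, ← ofReal_norm, Complex.norm_real, Real.norm_of_nonneg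
    (Finset.sum_nonneg fun s _ => hnn s), ENNReal.ofReal_sum_of_nonneg fun s _ => hnn s]
  refine Finset.sum_congr rfl fun s _ => ?_
  rw [ENNReal.ofReal_mul (sq_nonneg _), ENNReal.ofReal_pow (norm_nonneg _), ofReal_norm, mul_comm]
  rfl

theorem measurableSet_strictMono (N : ℕ) : MeasurableSet {z : Fin N → ℝ | StrictMono z} :=
  (isOpen_strictMono_comp (1 : Equiv.Perm (Fin N))).measurableSet

/-- The right-hand side does not involve the surface. Almost everywhere the characteristic values
are distinct, and there the unimodular phases disappear, so that the density is the symmetric one.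
-/
theorem IsSpacelikeCauchy.factorial_mul_lintegral (hf : IsSpacelikeCauchy f)
    (hg : ContinuousOn g (ordered (n + 1))) :
    ((n + 1).factorial : ℝ≥0∞) *
      ∫⁻ z in surfaceDomain (n + 1) f, ‖surfaceDensity (solution φ g) f z‖ₑ =
      ∑ s, ∫⁻ c, weight g s c := by
  rw [← hf.lintegral_symmDensity hg, lintegral_eq_factorial_mul (symmDensity_comp g f),
    hf.surfaceDomain_eq]
  congr 1
  refine lintegral_congr_ae (ae_restrict_of_ae ?_)
  filter_upwards [ae_all_iff.2 fun s : SpinIdx (n + 1) => hf.ae_injective s] with z hz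
  rw [hf.enorm_surfaceDensity, symmDensity]
  exact Finset.sum_congr rfl fun s _ => by rw [enorm_solution_sq (hz s)]

theorem IsSpacelikeCauchy.continuousOn_surfaceDensity (hf : IsSpacelikeCauchy f) {N : ℕ}
    {ψ : Config N → SpinSpace N} (hψ : ContinuousOn ψ (closure (S₁ N))) :
    ContinuousOn (surfaceDensity ψ f) (surfaceDomain N f) := by
  have h0 : ContinuousOn (fun z : Fin N → ℝ => ψ (surfacePoint f z)) (surfaceDomain N f) :=
    hψ.comp hf.continuous_surfacePoint.continuousOn fun z hz => subset_closure hz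
  have h1 : ∀ s, ContinuousOn (fun z : Fin N → ℝ => ‖ψ (surfacePoint f z) s‖ ^ 2 * jacobian f s z)
      (surfaceDomain N f) := fun s =>
    ((continuousOn_pi.1 h0 s).norm.pow 2).mul (hf.continuous_jacobian s).continuousOn
  have h2 := Complex.continuous_ofReal.comp_continuousOn
    (continuousOn_finsetSum Finset.univ fun s _ => h1 s)
  exact h2.congr fun z _ => surfaceDensity_eq ψ f z

/-- The density is real and nonnegative. If the mass is infinite, both sides are `0` by convention.
-/
theorem IsSpacelikeCauchy.integral_surfaceDensity (hf : IsSpacelikeCauchy f) {N : ℕ}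
    {ψ : Config N → SpinSpace N} (hψ : ContinuousOn ψ (closure (S₁ N))) :
    ∫ z in surfaceDomain N f, surfaceDensity ψ f z =
      ((∫⁻ z in surfaceDomain N f, ‖surfaceDensity ψ f z‖ₑ).toReal : ℂ) := by
  have hmeas : MeasurableSet (surfaceDomain N f) :=
    hf.surfaceDomain_eq N ▸ measurableSet_strictMono N
  have haes := (hf.continuousOn_surfaceDensity hψ).aestronglyMeasurable (μ := volume) hmeas
  have h1 : ∀ z, surfaceDensity ψ f z = ((‖surfaceDensity ψ f z‖ : ℝ) : ℂ) := by
    intro z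
    rw [surfaceDensity_eq, Complex.norm_real, Real.norm_of_nonneg]
    exact Finset.sum_nonneg fun s _ => mul_nonneg (sq_nonneg _) (hf.jacobian_pos s z).le
  rw [← integral_norm_eq_lintegral_enorm haes, ← integral_complex_ofReal]
  exact integral_congr_ae (Filter.Eventually.of_forall h1)

theorem conservesProbability_solution (hg : AdmissibleData m φ g) :
    ConservesProbability (solution φ g) := by
  intro f f' hf hf'
  have hψ := (contDiffOn_solution hg).continuousOn
  have hgc := hg.smooth.continuousOn
  have hfac : ((n + 1).factorial : ℝ≥0∞) ≠ 0 := by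
    exact_mod_cast (n + 1).factorial_ne_zero
  have heq : ∫⁻ z in surfaceDomain (n + 1) f, ‖surfaceDensity (solution φ g) f z‖ₑ =
      ∫⁻ z in surfaceDomain (n + 1) f', ‖surfaceDensity (solution φ g) f' z‖ₑ :=
    (ENNReal.mul_right_inj hfac (ENNReal.natCast_ne_top _)).1
      ((hf.factorial_mul_lintegral hgc).trans (hf'.factorial_mul_lintegral hgc).symm)
  have hint : ∀ f, IsSpacelikeCauchy f →
      (IntegrableOn (surfaceDensity (solution φ g) f) (surfaceDomain (n + 1) f) ↔
        ∫⁻ z in surfaceDomain (n + 1) f, ‖surfaceDensity (solution φ g) f z‖ₑ < ⊤) := by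
    intro f hf
    have hmeas : MeasurableSet (surfaceDomain (n + 1) f) :=
      hf.surfaceDomain_eq (n + 1) ▸ measurableSet_strictMono (n + 1)
    exact and_iff_right ((hf.continuousOn_surfaceDensity hψ).aestronglyMeasurable hmeas)
  exact ⟨by rw [hint f hf, hint f' hf', heq],
    by rw [hf.integral_surfaceDensity hψ, hf'.integral_surfaceDensity hψ, heq]⟩

end

section

/-! ### Lorentz invariance -/

theorem boostConfig_zero_apply {N : ℕ} (β : ℝ) (x : Config N) (k : Fin N) :
    boostConfig β x k 0 = Real.cosh (2 * β) * x k 0 + Real.sinh (2 * β) * x k 1 := by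
  simp [boostConfig, boost, Matrix.mulVec, dotProduct, Fin.sum_univ_two]

theorem boostConfig_one_apply {N : ℕ} (β : ℝ) (x : Config N) (k : Fin N) :
    boostConfig β x k 1 = Real.sinh (2 * β) * x k 0 + Real.cosh (2 * β) * x k 1 := by
  simp [boostConfig, boost, Matrix.mulVec, dotProduct, Fin.sum_univ_two]

/-- The null directions are the eigenvectors of a boost. Positivity of the factor preserves all the
orderings that define the domain. -/
theorem nullCoord_boostConfig {N : ℕ} (b : Fin 2) (β : ℝ) (x : Config N) (k : Fin N) :
    nullCoord b (boostConfig β x) k = Real.exp (sgn b * (2 * β)) * nullCoord b x k := by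
  rw [nullCoord, boostConfig_zero_apply, boostConfig_one_apply, nullCoord]
  fin_cases b
  · simp only [Fin.zero_eta, sgn_zero, neg_mul, one_mul]
    rw [← Real.cosh_sub_sinh]
    ring
  · simp only [Fin.mk_one, sgn_one, one_mul]
    rw [← Real.cosh_add_sinh]
    ring

theorem config_ext {N : ℕ} {x y : Config N} (h : ∀ b k, nullCoord b x k = nullCoord b y k) :
    x = y := by
  ext k i
  have h0 := h 0 k
  have h1 := h 1 k
  simp only [nullCoord, sgn_zero, sgn_one] at h0 h1
  fin_cases i <;> simp <;> linarith

theorem boostConfig_boostConfig_neg {N : ℕ} (β : ℝ) (x : Config N) :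
    boostConfig β (boostConfig (-β) x) = x := by
  refine config_ext fun b k => ?_
  rw [nullCoord_boostConfig, nullCoord_boostConfig, ← mul_assoc, ← Real.exp_add]
  simp

theorem charValue_boostConfig {N : ℕ} (s : SpinIdx N) (β : ℝ) (x : Config N) (k : Fin N) :
    charValue s (boostConfig β x) k = Real.exp (sgn (s k) * (2 * β)) * charValue s x k :=
  nullCoord_boostConfig (s k) β x k

theorem boostConfig_mem_S₁ {N : ℕ} (β : ℝ) {x : Config N} (hx : x ∈ S₁ N) :
    boostConfig β x ∈ S₁ N := by
  rw [mem_S₁_iff] at hx ⊢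
  intro b i j hij
  rw [nullCoord_boostConfig, nullCoord_boostConfig]
  exact mul_lt_mul_of_pos_left (hx b hij) (Real.exp_pos _)

theorem boostConfig_mem_closure_S₁ {N : ℕ} (β : ℝ) {x : Config N} (hx : x ∈ closure (S₁ N)) :
    boostConfig β x ∈ closure (S₁ N) := by
  rw [mem_closure_S₁_iff] at hx ⊢
  intro b i j hij
  rw [nullCoord_boostConfig, nullCoord_boostConfig]
  exact mul_le_mul_of_nonneg_left (hx b hij) (Real.exp_pos _).le

theorem boostConfig_mem_coincidence {n : ℕ} (β : ℝ) {k : Fin n} {x : Config (n + 1)}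
    (hx : x ∈ coincidence k) : boostConfig β x ∈ coincidence k :=
  ⟨boostConfig_mem_closure_S₁ β hx.1, by simp only [boostConfig, hx.2]⟩

theorem boostConfig_image_eq {N : ℕ} {A : Set (Config N)}
    (h : ∀ β, ∀ x ∈ A, boostConfig β x ∈ A) (β : ℝ) : boostConfig β '' A = A := by
  refine Set.Subset.antisymm (Set.image_subset_iff.2 fun x hx => h β x hx) fun x hx => ?_
  exact ⟨boostConfig (-β) x, h _ x hx, boostConfig_boostConfig_neg β x⟩

theorem contDiff_boostConfig {N : ℕ} (β : ℝ) {m : ℕ∞ω} :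
    ContDiff ℝ m (boostConfig β : Config N → Config N) := by
  refine contDiff_pi.2 fun k => contDiff_pi.2 fun i => ?_
  fin_cases i
  · simp only [Fin.zero_eta, boostConfig_zero_apply]
    fun_prop
  · simp only [Fin.mk_one, boostConfig_one_apply]
    fun_prop

theorem boostConfig_add_smul {N : ℕ} (β : ℝ) (x v : Config N) (t : ℝ) :
    boostConfig β (x + t • v) = boostConfig β x + t • boostConfig β v := by
  ext k : 1
  simp [boostConfig, Matrix.mulVec_add, Matrix.mulVec_smul]

/-- The factor by which the component `s` is multiplied by a boost. -/
def spinFactor {N : ℕ} (β : ℝ) (s : SpinIdx N) : ℂ := ∏ k, spinBoost β (s k) (s k)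

theorem lorentzTransform_apply {N : ℕ} (β : ℝ) (ψ : Config N → SpinSpace N) (x : Config N)
    (s : SpinIdx N) :
    lorentzTransform β ψ x s = spinFactor β s * ψ (boostConfig (-β) x) s := by
  have h : spinBoost β = Matrix.diagonal fun a => spinBoost β a a := by
    ext a b
    fin_cases a <;> fin_cases b <;> simp [spinBoost]
  rw [lorentzTransform, h, tensorMatrix_diagonal, Matrix.mulVec_diagonal]
  rfl

variable {n m : ℕ} {φ : Fin n → ℝ}

theorem contDiffOn_lorentzTransform {N : ℕ} (β : ℝ) {ψ : Config N → SpinSpace N}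
    (hψ : ContDiffOn ℝ m ψ (closure (S₁ N))) :
    ContDiffOn ℝ m (lorentzTransform β ψ) (closure (S₁ N)) := by
  refine contDiffOn_pi.2 fun s => ?_
  have h : ContDiffOn ℝ m (fun x => spinFactor β s * ψ (boostConfig (-β) x) s)
      (closure (S₁ N)) :=
    contDiffOn_const.mul ((contDiffOn_pi.1 hψ s).comp (contDiff_boostConfig (-β)).contDiffOn
      fun x hx => boostConfig_mem_closure_S₁ (-β) hx)
  exact h.congr fun x _ => lorentzTransform_apply β ψ x s

theorem solvesDirac_lorentzTransform {N : ℕ} (hm : 1 ≤ m) (β : ℝ) {ψ : Config N → SpinSpace N}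
    (hψ : ContDiffOn ℝ m ψ (closure (S₁ N))) (hD : SolvesDirac ψ) :
    SolvesDirac (lorentzTransform β ψ) := by
  rw [solvesDirac_iff]
  intro x hx k s
  rw [← sub_eq_zero, ← fderiv_nullVec]
  set v : Config N := nullVec k (s k)
  have hBx := boostConfig_mem_S₁ (-β) hx
  -- A boost scales characteristic values, hence preserves the directions in which they do not
  -- change.
  have hv : charValue s (boostConfig (-β) v) = 0 := by
    ext j
    have h := congrFun (charValue_add_smul_nullVec s 0 k 1) j
    have h0 : charValue s (0 : Config N) j = 0 := by simp [charValue]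
    rw [zero_add, one_smul, h0] at h
    rw [charValue_boostConfig, h, mul_zero, Pi.zero_apply]
  have h1 : HasDerivAt (fun t : ℝ => lorentzTransform β ψ (x + t • v) s)
      (fderiv ℝ (lorentzTransform β ψ) x v s) 0 :=
    hasDerivAt_pi.1 ((differentiableAt_of_contDiffOn hm
      (contDiffOn_lorentzTransform β hψ) hx).hasFDerivAt.hasLineDerivAt v) s
  have h2 : HasDerivAt (fun t : ℝ => ψ (boostConfig (-β) x + t • boostConfig (-β) v) s)
      (fderiv ℝ ψ (boostConfig (-β) x) (boostConfig (-β) v) s) 0 :=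
    hasDerivAt_pi.1 ((differentiableAt_of_contDiffOn hm hψ hBx).hasFDerivAt.hasLineDerivAt _) s
  rw [hD.fderiv_eq_zero hBx hv] at h2
  have h3 := h2.const_mul (spinFactor β s)
  rw [mul_zero] at h3
  refine h1.unique (h3.congr_of_eventuallyEq (Filter.Eventually.of_forall fun t => ?_))
  simp only [lorentzTransform_apply, boostConfig_add_smul]

theorem SolvesModel.lorentzTransform (hm : 1 ≤ m) (β : ℝ)
    {ψ : Config (n + 1) → SpinSpace (n + 1)} (hψ : SolvesModel m φ ψ) :
    SolvesModel m φ (lorentzTransform β ψ) where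
  smooth := contDiffOn_lorentzTransform β hψ.smooth
  dirac := solvesDirac_lorentzTransform hm β hψ.smooth hψ.dirac
  boundary k x hx s h1 h0 := by
    -- All particles carry the same spinor matrix, so the factor is symmetric and cancels from the
    -- boundary condition.
    have hs : spinFactor β (s ∘ adjSwap k) = spinFactor β s :=
      Equiv.prod_comp (adjSwap k) fun k => spinBoost β (s k) (s k)
    rw [lorentzTransform_apply, lorentzTransform_apply, hs,
      hψ.boundary k _ (boostConfig_mem_coincidence (-β) hx) s h1 h0]
    ring

theorem lorentzInvariant (hm : 1 ≤ m) (φ : Fin n → ℝ) : LorentzInvariant m φ := fun β =>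
  ⟨boostConfig_image_eq (fun β _ hx => boostConfig_mem_S₁ β hx) β,
    fun _ => boostConfig_image_eq (fun β _ hx => boostConfig_mem_coincidence β hx) β,
    fun _ hψ => hψ.lorentzTransform hm β⟩

end

end MultiTimeDirac

end

theorem theorem1 (n : ℕ) (φ : Fin n → ℝ) (m : ℕ) (hm : 1 ≤ m) :
    (∀ g : (Fin (n + 1) → ℝ) → MultiTimeDirac.SpinSpace (n + 1),
      MultiTimeDirac.AdmissibleData m φ g →
      ∃ ψ : MultiTimeDirac.Config (n + 1) → MultiTimeDirac.SpinSpace (n + 1),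
        MultiTimeDirac.SolvesIBVP m φ g ψ ∧
        (∀ ψ', MultiTimeDirac.SolvesIBVP m φ g ψ' →
          Set.EqOn ψ' ψ (closure (MultiTimeDirac.S₁ (n + 1)))) ∧
        (∀ s, ∀ x ∈ MultiTimeDirac.distinctSet s,
          MultiTimeDirac.ExplicitFormulaAt φ g ψ s x) ∧
        (∀ s, ∀ x ∈ closure (MultiTimeDirac.S₁ (n + 1)),
          x ∈ closure (MultiTimeDirac.distinctSet s) ∧
          Filter.Tendsto (fun y => ψ y s) (𝓝[MultiTimeDirac.distinctSet s] x) (𝓝 (ψ x s))) ∧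
        MultiTimeDirac.ConservesProbability ψ) ∧
    MultiTimeDirac.LorentzInvariant m φ := by
  refine ⟨fun g hg => ⟨MultiTimeDirac.solution φ g, MultiTimeDirac.solvesIBVP_solution hm hg,
    fun ψ' hψ' => hψ'.eqOn_solution hm,
    fun s x hx => MultiTimeDirac.explicitFormulaAt_solution φ g hx, fun s x hx => ⟨?_, ?_⟩,
    MultiTimeDirac.conservesProbability_solution hg⟩, MultiTimeDirac.lorentzInvariant hm φ⟩
  · exact MultiTimeDirac.mem_closure_distinctSet s hx
  · exact MultiTimeDirac.tendsto_distinctSet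
      (MultiTimeDirac.contDiffOn_solution hg).continuousOn s hx
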